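/- Let $X$ be a compact connected Riemann surface with canonical bundle $K$, let $L$ be a holomorphic line bundle on $X$ of degree $d=\deg L$, let $E$ be a holomorphic rank-2 vector bundle on $X$ with trivial determinant, and let $\iota: L\hookrightarrow E$ be a nowhere-vanishing holomorphic morphism. Fix a trivialization $\det E\cong\mathcal O_X$ and let $\pi:E\to L^{-1}$ be the projection $e\mapsto(l\mapsto\iota(l)\wedge e)$, so that $0\to L\xrightarrow{\iota} E\xrightarrow{\pi} L^{-1}\to 0$ is exact. Let $\mathbf x\in H^1(X,L^2)$ be the class of this extension, represented in Dolbeault cohomology by the form $\bar\partial\sigma$, with values in $\operatorname{Hom}(L^{-1},L)=L^2$, for any smooth section $\sigma$ of $\operatorname{Hom}(L^{-1},E)$ with $\pi\circ\sigma=\mathrm{id}$. Let $\lambda\in\mathbb C$ and let $\nabla_\lambda:E\to E\otimes K$ be an $SL_2(\mathbb C)$ $\lambda$-connection on $E$, that is, an additive map of sheaves of holomorphic sections such that $\nabla_\lambda(fs)=\lambda\,df\otimes s+f\,\nabla_\lambda(s)$ for all local holomorphic functions $f$ and local holomorphic sections $s$ of $E$, and which induces the operator $\lambda\,d$ on $\det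 E\cong\mathcal O_X$. Let $c_{\mathbf x}(\nabla_\lambda)\in H^0(X,KL^{-2})$ be the $\mathcal O_X$-linear composition $$L\xrightarrow{\ \iota\ }E\xrightarrow{\ \nabla_\lambda\ }E\otimes K\xrightarrow{\ \pi\otimes 1\ }L^{-1}\otimes K .$$ Then the Serre duality pairing $\langle\cdot,\cdot\rangle:H^0(X,KL^{-2})\times H^1(X,L^2)\to\mathbb C$, given by $\langle c,[\beta]\rangle=\frac1{2\pi i}\int_X\beta\wedge c$, satisfies $$\langle c_{\mathbf x}(\nabla_\lambda),\mathbf x\rangle=\lambda d .$$ -/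

import Mathlib

open Bundle Manifold ContDiff Topology

set_option linter.unusedSectionVars false

noncomputable section
namespace RiemannSurface

/-! ### Holomorphic and smooth sections of holomorphic vector bundles on a Riemann surface -/

section Sections

variable {X : Type*} [TopologicalSpace X] [ChartedSpace ℂ X]
  (F : Type*) [NormedAddCommGroup F] [NormedSpace ℂ F]
  {V : X → Type*} [TopologicalSpace (TotalSpace F V)] [∀ p, AddCommGroup (V p)]
  [∀ p, Module ℂ (V p)] [∀ p, TopologicalSpace (V p)] [FiberBundle F V] [VectorBundle ℂ F V]

/-- The section `s` is holomorphic in a neighbourhood of `p` (`ω` means analytic). -/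
def HolAt (s : Π q, V q) (p : X) : Prop :=
  ContMDiffAt 𝓘(ℂ) (𝓘(ℂ).prod 𝓘(ℂ, F)) ω (fun q => TotalSpace.mk' F q (s q)) p

/-- The function `f` is holomorphic in a neighbourhood of `p`. -/
def HolFunAt (f : X → ℂ) (p : X) : Prop := ContMDiffAt 𝓘(ℂ) 𝓘(ℂ) ω f p

/-- The section `u` in the local holomorphic trivialization around `p`. -/
def coord (u : Π q, V q) (p : X) : X → F := fun q => (trivializationAt F V p ⟨q, u q⟩).2

/-- The section `u` is `C^∞` (over `ℝ`) at `p`. -/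
def SmoothAt (u : Π q, V q) (p : X) : Prop :=
  ContMDiffAt 𝓘(ℝ, ℂ) 𝓘(ℝ, F) ∞ (coord F u p) p

/-- The Wirtinger derivative `∂f/∂z`. -/
def dz {F : Type*} [NormedAddCommGroup F] [NormedSpace ℂ F] (f : ℂ → F) (z : ℂ) : F :=
  (1 / 2 : ℂ) • (fderiv ℝ f z 1 - Complex.I • fderiv ℝ f z Complex.I)

/-- The Wirtinger derivative `∂f/∂z̄`. -/
def dzbar {F : Type*} [NormedAddCommGroup F] [NormedSpace ℂ F] (f : ℂ → F) (z : ℂ) : F :=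
  (1 / 2 : ℂ) • (fderiv ℝ f z 1 + Complex.I • fderiv ℝ f z Complex.I)

/-- The coefficient of `dz̄` in `∂̄ u` at `p`, where `z` is the holomorphic chart around `p`, computed
in the holomorphic trivialization around `p`. -/
def dbarCoeff (u : Π q, V q) (p : X) : V p :=
  (trivializationAt F V p).symm p (dzbar (coord F u p ∘ (chartAt ℂ p).symm) (chartAt ℂ p p))

/-- The Dolbeault operator `∂̄` of a holomorphic vector bundle: the `V`-valued `(0,1)`-form `∂̄ u`
at `p`, a conjugate-linear function of tangent vectors. (Mathlib's tangent space at `p` is `ℂ`, by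
means of the chart `chartAt ℂ p`, so that `dz̄ (v)` is the conjugate of `v`.) -/
def dbar (u : Π q, V q) (p : X) : TangentSpace 𝓘(ℂ) p →ₛₗ[starRingEnd ℂ] V p where
  toFun v := (starRingEnd ℂ (show ℂ from v)) • dbarCoeff F u p
  map_add' v w := by rw [← add_smul, ← map_add]; rfl
  map_smul' a v := by rw [smul_smul, ← map_mul]; rfl

end Sections

section Lemmas
variable {X : Type*} [TopologicalSpace X] [ChartedSpace ℂ X]
  {F : Type*} [NormedAddCommGroup F] [NormedSpace ℂ F]
  {V : X → Type*} [TopologicalSpace (TotalSpace F V)] [∀ p, AddCommGroup (V p)]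
  [∀ p, Module ℂ (V p)] [∀ p, TopologicalSpace (V p)] [FiberBundle F V] [VectorBundle ℂ F V]

theorem coord_add (u w : Π q, V q) (p : X) :
    coord F (fun q => u q + w q) p =ᶠ[𝓝 p] coord F u p + coord F w p := by
  filter_upwards [(trivializationAt F V p).open_baseSet.mem_nhds
    (FiberBundle.mem_baseSet_trivializationAt' p)] with q hq
  exact ((trivializationAt F V p).linear ℂ hq).map_add _ _

theorem coord_smul (a : ℂ) (u : Π q, V q) (p : X) :
    coord F (fun q => a • u q) p =ᶠ[𝓝 p] a • coord F u p := by
  filter_upwards [(trivializationAt F V p).open_baseSet.mem_nhds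
    (FiberBundle.mem_baseSet_trivializationAt' p)] with q hq
  exact ((trivializationAt F V p).linear ℂ hq).map_smul _ _

theorem SmoothAt.add {u w : Π q, V q} {p : X} (hu : SmoothAt F u p) (hw : SmoothAt F w p) :
    SmoothAt F (fun q => u q + w q) p :=
  (ContMDiffAt.add hu hw).congr_of_eventuallyEq (coord_add u w p)

theorem SmoothAt.smul (a : ℂ) {u : Π q, V q} {p : X} (hu : SmoothAt F u p) :
    SmoothAt F (fun q => a • u q) p :=
  (((a • ContinuousLinearMap.id ℝ F : F →L[ℝ] F).contMDiff).contMDiffAt.comp p hu).congr_of_eventuallyEq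
    (coord_smul a u p)

theorem SmoothAt.zero (p : X) : SmoothAt F (fun q => (0 : V q)) p := by
  have h := coord_smul (F := F) 0 (fun q => (0 : V q)) p
  simp only [smul_zero, zero_smul] at h
  exact (contMDiffAt_const (c := (0 : F))).congr_of_eventuallyEq h

theorem SmoothAt.differentiableAt {u : Π q, V q} {p : X} (hu : SmoothAt F u p) :
    DifferentiableAt ℝ (coord F u p ∘ (chartAt ℂ p).symm) (chartAt ℂ p p) := by
  have h := (contMDiffAt_iff.1 hu).2
  simp only [mfld_simps] at h
  exact (contDiffWithinAt_univ.1 h).differentiableAt (by simp)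

theorem chart_eventually {f g : X → F} {p : X} (h : f =ᶠ[𝓝 p] g) :
    f ∘ (chartAt ℂ p).symm =ᶠ[𝓝 (chartAt ℂ p p)] g ∘ (chartAt ℂ p).symm := by
  have hc := (chartAt ℂ p).continuousAt_symm (mem_chart_target ℂ p)
  rw [ContinuousAt, (chartAt ℂ p).left_inv (mem_chart_source ℂ p)] at hc
  exact hc.eventually h

theorem dzbar_congr {f g : ℂ → F} {z : ℂ} (h : f =ᶠ[𝓝 z] g) : dzbar f z = dzbar g z := by
  simp only [dzbar, h.fderiv_eq]

theorem dbarCoeff_add {u w : Π q, V q} {p : X} (hu : SmoothAt F u p) (hw : SmoothAt F w p) :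
    dbarCoeff F (fun q => u q + w q) p = dbarCoeff F u p + dbarCoeff F w p := by
  have : dzbar ((coord F u p + coord F w p) ∘ (chartAt ℂ p).symm) (chartAt ℂ p p) =
      dzbar (coord F u p ∘ (chartAt ℂ p).symm) (chartAt ℂ p p) +
      dzbar (coord F w p ∘ (chartAt ℂ p).symm) (chartAt ℂ p p) := by
    have h := fderiv_add hu.differentiableAt hw.differentiableAt
    have h' : (coord F u p + coord F w p) ∘ (chartAt ℂ p).symm =
      coord F u p ∘ (chartAt ℂ p).symm + coord F w p ∘ (chartAt ℂ p).symm := rfl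
    simp only [dzbar, h', h, ContinuousLinearMap.add_apply]
    module
  simp only [dbarCoeff]
  rw [dzbar_congr (chart_eventually (coord_add u w p)), this]
  rw [← (trivializationAt F V p).coe_symmₗ (R := ℂ)
    (FiberBundle.mem_baseSet_trivializationAt' p)]
  exact map_add _ _ _

theorem dbarCoeff_smul (a : ℂ) {u : Π q, V q} {p : X} (hu : SmoothAt F u p) :
    dbarCoeff F (fun q => a • u q) p = a • dbarCoeff F u p := by
  have : dzbar ((a • coord F u p) ∘ (chartAt ℂ p).symm) (chartAt ℂ p p) =
      a • dzbar (coord F u p ∘ (chartAt ℂ p).symm) (chartAt ℂ p p) := by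
    have h := fderiv_const_smul hu.differentiableAt a
    have h' : (a • coord F u p) ∘ (chartAt ℂ p).symm =
      a • (coord F u p ∘ (chartAt ℂ p).symm) := rfl
    simp only [dzbar, h', h, smul_apply]
    module
  simp only [dbarCoeff]
  rw [dzbar_congr (chart_eventually (coord_smul a u p)), this]
  rw [← (trivializationAt F V p).coe_symmₗ (R := ℂ)
    (FiberBundle.mem_baseSet_trivializationAt' p)]
  exact map_smul _ _ _

theorem dbar_add {u w : Π q, V q} {p : X} (hu : SmoothAt F u p) (hw : SmoothAt F w p) :
    dbar F (fun q => u q + w q) p = dbar F u p + dbar F w p :=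
  LinearMap.ext fun _ => (congrArg _ (dbarCoeff_add hu hw)).trans (smul_add _ _ _)

theorem dbar_smul (a : ℂ) {u : Π q, V q} {p : X} (hu : SmoothAt F u p) :
    dbar F (fun q => a • u q) p = a • dbar F u p :=
  LinearMap.ext fun _ => (congrArg _ (dbarCoeff_smul a hu)).trans (smul_comm _ _ _)

end Lemmas

/-! ### Integration of 2-forms -/

section Integral

variable {X : Type*} [TopologicalSpace X] [ChartedSpace ℂ X]

/-- The real `C^∞` structure underlying a Riemann surface. -/
theorem isManifold_real [IsManifold 𝓘(ℂ) ω X] : IsManifold 𝓘(ℝ, ℂ) ∞ X := by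
  refine isManifold_of_contDiffOn _ _ _ fun e e' he he' => ?_
  have h := (contDiffGroupoid ω 𝓘(ℂ)).compatible he he'
  rw [contDiffGroupoid, mem_groupoid_of_pregroupoid] at h
  have h1 : ContDiffOn ℂ ω (e.symm.trans e') (e.symm.trans e').source := by
    simpa [contDiffPregroupoid] using h.1
  simpa using (h1.restrict_scalars ℝ).of_le le_top

variable [IsManifold 𝓘(ℂ) ω X] [T2Space X] [CompactSpace X]

variable (X) in
/-- A smooth partition of unity subordinate to the cover of `X` by the coordinate charts. -/
def partitionOfUnity : SmoothPartitionOfUnity X 𝓘(ℝ, ℂ) X Set.univ :=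
  haveI : IsManifold 𝓘(ℝ, ℂ) ∞ X := isManifold_real
  (SmoothPartitionOfUnity.exists_isSubordinate_chartAt_source 𝓘(ℝ, ℂ) X).choose

/-- The tangent vector at `q` which corresponds to `w : ℂ` in the coordinate chart around `p`;
`w = 1` gives `∂/∂x` and `w = i` gives `∂/∂y`. -/
def coordVec (p q : X) (w : ℂ) : TangentSpace 𝓘(ℂ) q :=
  (trivializationAt ℂ (TangentSpace 𝓘(ℂ) : X → Type _) p).symm q w

/-- The integral over `X`, with its orientation as a complex manifold, of the 2-form `η`, given by
its values on pairs of tangent vectors: a partition of unity reduces it to integrals of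
`η(∂/∂x, ∂/∂y) dx dy` in coordinate charts. -/
def integral (η : Π p : X, TangentSpace 𝓘(ℂ) p → TangentSpace 𝓘(ℂ) p → ℂ) : ℂ :=
  ∑ᶠ p : X, ∫ z in (chartAt ℂ p).target,
    (partitionOfUnity X p ((chartAt ℂ p).symm z) : ℂ) *
      η ((chartAt ℂ p).symm z) (coordVec p _ 1) (coordVec p _ Complex.I)

end Integral

section LineBundle

variable {X : Type*} [TopologicalSpace X] [ChartedSpace ℂ X] [IsManifold 𝓘(ℂ) ω X]
  (L : X → Type*) [TopologicalSpace (TotalSpace ℂ L)] [∀ p, AddCommGroup (L p)]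
  [∀ p, Module ℂ (L p)] [∀ p, TopologicalSpace (L p)] [FiberBundle ℂ L] [VectorBundle ℂ ℂ L]

/-! ### The degree of a holomorphic line bundle -/

/-- A smooth Hermitian metric on `L`, given by `l ↦ |l|²`. -/
structure HermitianMetric where
  normSq : Π p, L p → ℝ
  normSq_pos : ∀ p (l : L p), l ≠ 0 → 0 < normSq p l
  normSq_smul : ∀ p (a : ℂ) (l : L p), normSq p (a • l) = ‖a‖ ^ 2 * normSq p l
  smooth : ∀ p (s : Π q, L q), HolAt ℂ s p →
    ContMDiffAt 𝓘(ℝ, ℂ) 𝓘(ℝ) ∞ (fun q => normSq q (s q)) p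

variable {L}

/-- The curvature `∂̄∂ log |e|²` of the Chern connection of a Hermitian metric, where `e` is a
local holomorphic frame of `L`; here `(dz̄ ∧ dz)(v, w) = v̄ w - w̄ v`. -/
def HermitianMetric.curvature (h : HermitianMetric L) (p : X) (v w : TangentSpace 𝓘(ℂ) p) : ℂ :=
  dzbar (dz fun z => (Real.log (h.normSq ((chartAt ℂ p).symm z)
      ((trivializationAt ℂ L p).symm ((chartAt ℂ p).symm z) 1)) : ℂ)) (chartAt ℂ p p) *
    (starRingEnd ℂ (show ℂ from v) * (show ℂ from w) -
      starRingEnd ℂ (show ℂ from w) * (show ℂ from v))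

/-- Holomorphic functions are smooth. -/
theorem HolFunAt.contMDiffAt_real {X : Type*} [TopologicalSpace X] [ChartedSpace ℂ X]
    {f : X → ℂ} {p : X} (hf : HolFunAt f p) : ContMDiffAt 𝓘(ℝ, ℂ) 𝓘(ℝ, ℂ) ∞ f p := by
  have h := contMDiffAt_iff.1 hf
  refine contMDiffAt_iff.2 ⟨h.1, ?_⟩
  have h2 := h.2
  simp only [mfld_simps] at h2 ⊢
  exact (h2.restrict_scalars ℝ).of_le le_top

theorem HermitianMetric.nonempty {X : Type*} [TopologicalSpace X] [ChartedSpace ℂ X]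
    [IsManifold 𝓘(ℂ) ω X] [T2Space X] [CompactSpace X]
    (L : X → Type*) [TopologicalSpace (TotalSpace ℂ L)] [∀ p, AddCommGroup (L p)]
    [∀ p, Module ℂ (L p)] [∀ p, TopologicalSpace (L p)] [FiberBundle ℂ L] [VectorBundle ℂ ℂ L]
    [ContMDiffVectorBundle ω ℂ L 𝓘(ℂ)] : Nonempty (HermitianMetric L) := by
  haveI : IsManifold 𝓘(ℝ, ℂ) ∞ X := isManifold_real
  obtain ⟨ρ, hρ⟩ := SmoothPartitionOfUnity.exists_isSubordinate 𝓘(ℝ, ℂ) (s := (Set.univ : Set X))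
    isClosed_univ (fun p : X => (trivializationAt ℂ L p).baseSet)
    (fun p => (trivializationAt ℂ L p).open_baseSet)
    (fun p _ => Set.mem_iUnion.2 ⟨p, FiberBundle.mem_baseSet_trivializationAt' p⟩)
  have hsub : ∀ i p, ρ i p ≠ 0 → p ∈ (trivializationAt ℂ L i).baseSet := fun i p h =>
    hρ i (subset_tsupport _ h)
  have hfin : ∀ (p : X) (l : L p), (Function.support fun i =>
      ρ i p * ‖(trivializationAt ℂ L i ⟨p, l⟩).2‖ ^ 2).Finite := fun p l =>
    (ρ.locallyFinite.point_finite p).subset fun i hi h => hi (by simp [h])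
  refine ⟨⟨fun p l => ∑ᶠ i, ρ i p * ‖(trivializationAt ℂ L i ⟨p, l⟩).2‖ ^ 2, ?_, ?_, ?_⟩⟩
  · intro p l hl
    obtain ⟨i, hi⟩ : ∃ i, ρ i p ≠ 0 := by
      by_contra! h
      have := ρ.sum_eq_one (Set.mem_univ p)
      simp [h] at this
    refine finsum_pos (fun j => mul_nonneg (ρ.nonneg j p) (by positivity)) ⟨i, ?_⟩ (hfin p l)
    refine mul_pos (lt_of_le_of_ne (ρ.nonneg i p) hi.symm)
      (pow_pos (norm_pos_iff.2 fun h => hl ?_) 2)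
    have h1 := (trivializationAt ℂ L i).symm_apply_apply_mk (hsub i p hi) l
    rw [h, ← (trivializationAt ℂ L i).coe_symmₗ (R := ℂ) (hsub i p hi), map_zero] at h1
    exact h1.symm
  · intro p a l
    rw [← smul_eq_mul, smul_finsum]
    refine finsum_congr fun i => ?_
    by_cases hi : ρ i p = 0
    · simp [hi]
    · rw [((trivializationAt ℂ L i).linear ℂ (hsub i p hi)).map_smul, norm_smul]
      simp only [smul_eq_mul]
      ring
  · intro p s hs
    refine ρ.contMDiffAt_finsum (g := fun i q => ‖(trivializationAt ℂ L i ⟨q, s q⟩).2‖ ^ 2)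
      fun i hi => ?_
    have h1 : HolFunAt (fun q => (trivializationAt ℂ L i ⟨q, s q⟩).2) p :=
      ((trivializationAt ℂ L i).contMDiffAt_section_iff (hρ i hi)).1 hs
    exact (contDiff_norm_sq ℝ).contMDiff.contMDiffAt.comp p h1.contMDiffAt_real

variable (L) in
/-- The degree of `L`: the integral of its first Chern form `(i/2π) F`, where `F` is the curvature
of a smooth Hermitian metric on `L`. (It does not depend on the metric.) -/
def degree [T2Space X] [CompactSpace X] [ContMDiffVectorBundle ω ℂ L 𝓘(ℂ)] : ℂ :=
  Complex.I / (2 * Real.pi) * integral (HermitianMetric.nonempty L).some.curvature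

/-! ### `H⁰(X, K L⁻²)`, `H¹(X, L²)` and Serre duality

`L⁻¹` is the dual of `L`, and `L²` is `Hom(L⁻¹, L)`. -/

/-- The section `ξ` of `L⁻¹` is holomorphic in a neighbourhood of `p`. -/
def HolDualAt (ξ : Π q, Module.Dual ℂ (L q)) (p : X) : Prop :=
  ∀ s : Π q, L q, HolAt ℂ s p → HolFunAt (fun q => ξ q (s q)) p

variable (L) in
/-- `H⁰(X, K L⁻²)`: holomorphic sections of `K ⊗ L⁻¹ ⊗ L⁻¹`. -/
structure H0KLinvSq where
  toFun : Π p, TangentSpace 𝓘(ℂ) p →ₗ[ℂ] L p →ₗ[ℂ] Module.Dual ℂ (L p)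
  holomorphic : ∀ (p : X) (v : Π q, TangentSpace 𝓘(ℂ) q) (s t : Π q, L q),
    HolAt ℂ v p → HolAt ℂ s p → HolAt ℂ t p → HolFunAt (fun q => toFun q (v q) (s q) (t q)) p

section Hom

variable (F : Type*) [NormedAddCommGroup F] [NormedSpace ℂ F]
  {V : X → Type*} [TopologicalSpace (TotalSpace F V)] [∀ p, AddCommGroup (V p)]
  [∀ p, Module ℂ (V p)] [∀ p, TopologicalSpace (V p)] [FiberBundle F V] [VectorBundle ℂ F V]

/-- `σ` is a smooth section of `Hom(L⁻¹, V)`. -/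
def SmoothHom (σ : Π p, Module.Dual ℂ (L p) →ₗ[ℂ] V p) : Prop :=
  ∀ p (ξ : Π q, Module.Dual ℂ (L q)), HolDualAt ξ p → SmoothAt F (fun q => σ q (ξ q)) p

/-- The equality `∂̄ σ = B`, where `σ` is a smooth section of `Hom(L⁻¹, V)` and `B` a `(0,1)`-form
with values in `Hom(L⁻¹, V)`. -/
def IsDbarHom (σ : Π p, Module.Dual ℂ (L p) →ₗ[ℂ] V p)
    (B : Π p : X, TangentSpace 𝓘(ℂ) p →ₛₗ[starRingEnd ℂ] Module.Dual ℂ (L p) →ₗ[ℂ] V p) : Prop :=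
  ∀ p (ξ : Π q, Module.Dual ℂ (L q)), HolDualAt ξ p →
    ∀ v, B p v (ξ p) = dbar F (fun q => σ q (ξ q)) p v

end Hom

end LineBundle

section H1

variable {X : Type*} [TopologicalSpace X] [ChartedSpace ℂ X] [IsManifold 𝓘(ℂ) ω X]
  (L : X → Type*) [TopologicalSpace (TotalSpace ℂ L)] [∀ p, AddCommGroup (L p)]
  [∀ p, Module ℂ (L p)] [∀ p, TopologicalSpace (L p)] [FiberBundle ℂ L] [VectorBundle ℂ ℂ L]

/-- The smooth `(0,1)`-forms with values in `L² = Hom(L⁻¹, L)`. -/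
def Form01Sq : Submodule ℂ
    (Π p : X, TangentSpace 𝓘(ℂ) p →ₛₗ[starRingEnd ℂ] Module.Dual ℂ (L p) →ₗ[ℂ] L p) where
  carrier := {β | ∀ p (v : Π q, TangentSpace 𝓘(ℂ) q) (ξ : Π q, Module.Dual ℂ (L q)),
    HolAt ℂ v p → HolDualAt ξ p → SmoothAt ℂ (fun q => β q (v q) (ξ q)) p}
  zero_mem' := fun p _ _ _ _ => SmoothAt.zero p
  add_mem' := fun h h' p v ξ hv hξ => (h p v ξ hv hξ).add (h' p v ξ hv hξ)
  smul_mem' := fun a _ h p v ξ hv hξ => (h p v ξ hv hξ).smul a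

/-- The image of `∂̄`, from the smooth sections of `L²` to the `(0,1)`-forms with values in `L²`. -/
def exactForms : Submodule ℂ (Form01Sq L) where
  carrier := {β | ∃ u : Π p, Module.Dual ℂ (L p) →ₗ[ℂ] L p, SmoothHom ℂ u ∧ IsDbarHom ℂ u β.1}
  zero_mem' := ⟨0, fun p _ _ => SmoothAt.zero p, fun p ξ _ v => by
    have h := LinearMap.congr_fun (dbar_smul (F := ℂ) 0 (SmoothAt.zero (V := L) p)) v
    simp only [smul_zero, zero_smul] at h
    exact h.symm⟩
  add_mem' := by
    rintro β β' ⟨u, hu, h⟩ ⟨u', hu', h'⟩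
    refine ⟨u + u', fun p ξ hξ => (hu p ξ hξ).add (hu' p ξ hξ), fun p ξ hξ v => ?_⟩
    exact (congrArg₂ (· + ·) (h p ξ hξ v) (h' p ξ hξ v)).trans
      (LinearMap.congr_fun (dbar_add (hu p ξ hξ) (hu' p ξ hξ)) v).symm
  smul_mem' := by
    rintro a β ⟨u, hu, h⟩
    refine ⟨a • u, fun p ξ hξ => (hu p ξ hξ).smul a, fun p ξ hξ v => ?_⟩
    exact (congrArg (a • ·) (h p ξ hξ v)).trans
      (LinearMap.congr_fun (dbar_smul a (hu p ξ hξ)) v).symm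

instance : AddCommGroup (Form01Sq L) := (Form01Sq L).addCommGroup

/-- `H¹(X, L²)`, as Dolbeault cohomology. -/
abbrev H1Sq := Form01Sq L ⧸ exactForms L

variable {L}

/-- The 2-form `β ∧ c`, where `c` is a `(1,0)`-form with values in `L⁻² = Hom(L, L⁻¹)` and `β` is a
`(0,1)`-form with values in `L² = Hom(L⁻¹, L)`; the values are multiplied by means of
`Hom(L⁻¹, L) ⊗ Hom(L, L⁻¹) → End(L) = ℂ`. -/
def wedge (β : Form01Sq L) (c : H0KLinvSq L) (p : X) (v w : TangentSpace 𝓘(ℂ) p) : ℂ :=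
  LinearMap.trace ℂ (L p) (β.1 p v ∘ₗ c.toFun p w) -
    LinearMap.trace ℂ (L p) (β.1 p w ∘ₗ c.toFun p v)

/-- The Serre duality pairing of `c ∈ H⁰(X, K L⁻²)` and `x ∈ H¹(X, L²)`, that is
`1/(2πi) ∫ β ∧ c` for a form `β` that represents `x`. (It does not depend on `β`.) -/
def serrePairing [T2Space X] [CompactSpace X] (c : H0KLinvSq L) (x : H1Sq L) : ℂ :=
  1 / (2 * Real.pi * Complex.I) * integral (wedge (Quotient.out x) c)

end H1

section Extension

variable {X : Type*} [TopologicalSpace X] [ChartedSpace ℂ X] [IsManifold 𝓘(ℂ) ω X]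
  (L : X → Type*) [TopologicalSpace (TotalSpace ℂ L)] [∀ p, AddCommGroup (L p)]
  [∀ p, Module ℂ (L p)] [∀ p, TopologicalSpace (L p)] [FiberBundle ℂ L] [VectorBundle ℂ ℂ L]
  (E : X → Type*) [TopologicalSpace (TotalSpace (Fin 2 → ℂ) E)] [∀ p, AddCommGroup (E p)]
  [∀ p, Module ℂ (E p)] [∀ p, TopologicalSpace (E p)] [FiberBundle (Fin 2 → ℂ) E]
  [VectorBundle ℂ (Fin 2 → ℂ) E]

/-- A trivialization of the determinant of the holomorphic rank-2 bundle `E`: a nowhere-vanishing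
holomorphic section of the bundle of alternating bilinear forms on `E`. -/
structure DetTrivialization where
  toFun : Π p, E p →ₗ[ℂ] E p →ₗ[ℂ] ℂ
  alternating : ∀ p (e : E p), toFun p e e = 0
  ne_zero : ∀ p, toFun p ≠ 0
  holomorphic : ∀ (p : X) (s t : Π q, E q), HolAt (Fin 2 → ℂ) s p → HolAt (Fin 2 → ℂ) t p →
    HolFunAt (fun q => toFun q (s q) (t q)) p

/-- A nowhere-vanishing holomorphic morphism `L ↪ E`. -/
structure Embedding where
  toFun : Π p, L p →ₗ[ℂ] E p
  ne_zero : ∀ p, toFun p ≠ 0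
  holomorphic : ∀ (p : X) (s : Π q, L q), HolAt ℂ s p →
    HolAt (Fin 2 → ℂ) (fun q => toFun q (s q)) p

variable {L E}

/-- The projection `E → L⁻¹` of the extension `0 → L → E → L⁻¹ → 0` that an embedding `ι : L ↪ E`
defines by means of `det E ≅ 𝒪`: it maps `e` to `l ↦ ι(l) ∧ e`. -/
def Embedding.proj (ι : Embedding L E) (D : DetTrivialization E) (p : X) :
    E p →ₗ[ℂ] Module.Dual ℂ (L p) :=
  ((D.toFun p).comp (ι.toFun p)).flip

/-- `x ∈ H¹(X, L²)` is the class of the extension `0 → L → E → L⁻¹ → 0`, i.e. the image of the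
identity under the connecting map `H⁰(Hom(L⁻¹, L⁻¹)) → H¹(Hom(L⁻¹, L))`: the identity lifts to a
smooth section `σ` of `Hom(L⁻¹, E)`, and `x` is represented by `∂̄ σ`, which takes its values in
`Hom(L⁻¹, L)`. -/
def Embedding.IsExtensionClass (ι : Embedding L E) (D : DetTrivialization E) (x : H1Sq L) : Prop :=
  ∃ (σ : Π p, Module.Dual ℂ (L p) →ₗ[ℂ] E p) (β : Form01Sq L),
    SmoothHom (Fin 2 → ℂ) σ ∧ (∀ p, ι.proj D p ∘ₗ σ p = LinearMap.id) ∧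
    IsDbarHom (Fin 2 → ℂ) σ (fun p => (LinearMap.compRight ℂ (ι.toFun p)).comp (β.1 p)) ∧
    x = Submodule.Quotient.mk β

/-- An `SL₂` `λ`-connection on `E`. It maps a section `s` and a point `p` near which `s` is
holomorphic to `v ↦ (∇_v s)(p)`, where `v` is a tangent vector at `p`. -/
structure LambdaConnection (lam : ℂ) (D : DetTrivialization E) where
  toFun : (Π p, E p) → Π p : X, TangentSpace 𝓘(ℂ) p →ₗ[ℂ] E p
  /-- the value at `p` depends on the germ of the section only -/
  congr : ∀ (p : X) (s t : Π q, E q), HolAt (Fin 2 → ℂ) s p → HolAt (Fin 2 → ℂ) t p →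
    (∀ᶠ q in 𝓝 p, s q = t q) → toFun s p = toFun t p
  add : ∀ (p : X) (s t : Π q, E q), HolAt (Fin 2 → ℂ) s p → HolAt (Fin 2 → ℂ) t p →
    toFun (fun q => s q + t q) p = toFun s p + toFun t p
  leibniz : ∀ (p : X) (f : X → ℂ) (s : Π q, E q), HolFunAt f p → HolAt (Fin 2 → ℂ) s p →
    ∀ v, toFun (fun q => f q • s q) p v = (lam * mvfderiv 𝓘(ℂ) f p v) • s p + f p • toFun s p v
  holomorphic : ∀ (p : X) (s : Π q, E q) (v : Π q, TangentSpace 𝓘(ℂ) q),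
    HolAt (Fin 2 → ℂ) s p → HolAt ℂ v p → HolAt (Fin 2 → ℂ) (fun q => toFun s q (v q)) p
  /-- the induced operator on `det E ≅ 𝒪` is `λ d` -/
  det : ∀ (p : X) (s t : Π q, E q), HolAt (Fin 2 → ℂ) s p → HolAt (Fin 2 → ℂ) t p →
    ∀ v, D.toFun p (toFun s p v) (t p) + D.toFun p (s p) (toFun t p v) =
      lam * mvfderiv 𝓘(ℂ) (fun q => D.toFun q (s q) (t q)) p v


section

variable [ContMDiffVectorBundle ω ℂ L 𝓘(ℂ)]

theorem Embedding.proj_apply_self (ι : Embedding L E) (D : DetTrivialization E) (p : X)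
    (l : L p) : ι.proj D p (ι.toFun p l) = 0 := by
  ext m
  have hp := FiberBundle.mem_baseSet_trivializationAt' (F := ℂ) (E := L) p
  have key : ∀ l : L p, ∃ a : ℂ, l = a • (trivializationAt ℂ L p).symm p 1 := fun l => by
    refine ⟨(trivializationAt ℂ L p ⟨p, l⟩).2, ?_⟩
    rw [← (trivializationAt ℂ L p).coe_symmₗ (R := ℂ) hp, ← map_smul, smul_eq_mul, mul_one]
    rw [(trivializationAt ℂ L p).coe_symmₗ (R := ℂ) hp]
    exact ((trivializationAt ℂ L p).symm_apply_apply_mk hp l).symm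
  obtain ⟨a, ha⟩ := key l
  obtain ⟨b, hb⟩ := key m
  rw [ha, hb]
  simp [Embedding.proj, D.alternating]

theorem LambdaConnection.proj_eq_zero {lam : ℂ} {D : DetTrivialization E}
    (N : LambdaConnection lam D) (ι : Embedding L E) {p : X} {r : Π q, L q}
    (hr : HolAt ℂ r p) (h0 : r p = 0) (v : TangentSpace 𝓘(ℂ) p) :
    ι.proj D p (N.toFun (fun q => ι.toFun q (r q)) p v) = 0 := by
  have hp := FiberBundle.mem_baseSet_trivializationAt' (F := ℂ) (E := L) p
  set T := trivializationAt ℂ L p with hT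
  let l0 : L p := T.symm p 1
  let g : X → ℂ := fun q => (T ⟨q, r q⟩).2
  have hg : HolFunAt g p := (contMDiffAt_totalSpace.1 hr).2
  have he : HolAt ℂ (FiberBundle.extend ℂ l0) p := FiberBundle.contMDiffAt_extend 𝓘(ℂ) ℂ l0
  have hιe := ι.holomorphic p _ he
  have hge : HolAt ℂ (fun q => g q • FiberBundle.extend ℂ l0 q) p := hg.smul_section he
  have hev : ∀ᶠ q in 𝓝 p, ι.toFun q (r q) = g q • ι.toFun q (FiberBundle.extend ℂ l0 q) := by
    filter_upwards [T.open_baseSet.mem_nhds hp] with q hq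
    rw [← map_smul]
    congr 1
    have : (T ⟨p, l0⟩).2 = 1 := by simp [l0, T.apply_mk_symm hp]
    simp only [FiberBundle.extend, ← hT, this]
    rw [← T.coe_symmₗ (R := ℂ) hq, ← map_smul, smul_eq_mul, mul_one,
      T.coe_symmₗ (R := ℂ) hq]
    exact (T.symm_apply_apply_mk hq _).symm
  have hg0 : g p = 0 := by
    have := (T.linear ℂ hp).map_zero
    simpa [g, h0] using this
  rw [N.congr p _ (fun q => g q • ι.toFun q (FiberBundle.extend ℂ l0 q)) (ι.holomorphic p _ hr)
    (hg.smul_section hιe) hev, N.leibniz p g _ hg hιe v,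
    hg0, zero_smul, add_zero, map_smul, ι.proj_apply_self, smul_zero]

theorem LambdaConnection.proj_congr {lam : ℂ} {D : DetTrivialization E}
    (N : LambdaConnection lam D) (ι : Embedding L E) {p : X} {s t : Π q, L q}
    (hs : HolAt ℂ s p) (ht : HolAt ℂ t p) (h : s p = t p) (v : TangentSpace 𝓘(ℂ) p) :
    ι.proj D p (N.toFun (fun q => ι.toFun q (s q)) p v) =
      ι.proj D p (N.toFun (fun q => ι.toFun q (t q)) p v) := by
  have hr : HolAt ℂ (fun q => s q - t q) p := ContMDiffAt.sub_section hs ht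
  have h1 := N.add p _ _ (ι.holomorphic p _ hr) (ι.holomorphic p _ ht)
  have h2 : (fun q => ι.toFun q (s q - t q) + ι.toFun q (t q)) = fun q => ι.toFun q (s q) := by
    funext q
    rw [← map_add, sub_add_cancel]
  rw [h2] at h1
  rw [h1, LinearMap.add_apply, map_add, N.proj_eq_zero ι hr (sub_eq_zero.2 h) v, zero_add]

/-- The composition `L → E → E ⊗ K → L⁻¹ ⊗ K` at `p`, with `∇` in the middle: the vector `l` is
extended to a local holomorphic section of `L`. -/
def LambdaConnection.cAt {lam : ℂ} {D : DetTrivialization E}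
    (N : LambdaConnection lam D) (ι : Embedding L E) (p : X) :
    TangentSpace 𝓘(ℂ) p →ₗ[ℂ] L p →ₗ[ℂ] Module.Dual ℂ (L p) :=
  LinearMap.mk₂ ℂ
    (fun v l => ι.proj D p (N.toFun (fun q => ι.toFun q (FiberBundle.extend ℂ l q)) p v))
    (fun v w l => by rw [map_add, map_add])
    (fun a v l => by rw [map_smul, map_smul])
    (fun v l m => by
      have hl : HolAt ℂ (FiberBundle.extend ℂ l) p := FiberBundle.contMDiffAt_extend 𝓘(ℂ) ℂ l
      have hm : HolAt ℂ (FiberBundle.extend ℂ m) p := FiberBundle.contMDiffAt_extend 𝓘(ℂ) ℂ m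
      have hlm : HolAt ℂ (FiberBundle.extend ℂ (l + m)) p :=
        FiberBundle.contMDiffAt_extend 𝓘(ℂ) ℂ (l + m)
      have h : HolAt ℂ (fun q => FiberBundle.extend ℂ l q + FiberBundle.extend ℂ m q) p :=
        ContMDiffAt.add_section hl hm
      rw [N.proj_congr ι hlm h (by simp) v]
      have h1 := N.add p _ _ (ι.holomorphic p _ hl) (ι.holomorphic p _ hm)
      simp only [map_add]
      rw [h1, LinearMap.add_apply, map_add])
    (fun a v l => by
      have hl : HolAt ℂ (FiberBundle.extend ℂ l) p := FiberBundle.contMDiffAt_extend 𝓘(ℂ) ℂ l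
      have hal : HolAt ℂ (FiberBundle.extend ℂ (a • l)) p :=
        FiberBundle.contMDiffAt_extend 𝓘(ℂ) ℂ (a • l)
      have ha : HolFunAt (fun _ : X => a) p := contMDiffAt_const
      have h : HolAt ℂ (fun q => a • FiberBundle.extend ℂ l q) p :=
        ContMDiffAt.smul_section ha hl
      rw [N.proj_congr ι hal h (by simp) v]
      have h1 := N.leibniz p _ _ ha (ι.holomorphic p _ hl) v
      simp only [map_smul]
      rw [h1, map_add, map_smul, map_smul, ι.proj_apply_self, smul_zero, zero_add])

theorem LambdaConnection.cAt_apply {lam : ℂ} {D : DetTrivialization E}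
    (N : LambdaConnection lam D) (ι : Embedding L E) {p : X} {s : Π q, L q} (hs : HolAt ℂ s p)
    (v : TangentSpace 𝓘(ℂ) p) :
    N.cAt ι p v (s p) = ι.proj D p (N.toFun (fun q => ι.toFun q (s q)) p v) :=
  N.proj_congr ι (FiberBundle.contMDiffAt_extend 𝓘(ℂ) ℂ (s p)) hs (by simp) v

/-- The section `c_x(∇)` of `K L⁻²` which is the composition `L → E → E ⊗ K → L⁻¹ ⊗ K`. -/
def LambdaConnection.c {lam : ℂ} {D : DetTrivialization E}
    (N : LambdaConnection lam D) (ι : Embedding L E) : H0KLinvSq L where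
  toFun := N.cAt ι
  holomorphic p v s t hv hs ht := by
    have h := D.holomorphic p _ _ (ι.holomorphic p t ht)
      (N.holomorphic p _ v (ι.holomorphic p s hs) hv)
    refine ContMDiffAt.congr_of_eventuallyEq h ?_
    filter_upwards [(contMDiffAt_iff_contMDiffAt_nhds (by simp)).1 hs] with q hq
    exact congrArg (fun φ : Module.Dual ℂ (L q) => φ (t q)) (N.cAt_apply ι hq (v q))

end
end Extension

end RiemannSurface

end

noncomputable section
namespace RiemannSurface

/-! ### Wirtinger derivatives -/

section Wirtinger

open MeasureTheory

variable {G : Type*} [NormedAddCommGroup G] [NormedSpace ℂ G]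

/-! A smooth splitting `σ` of `E → L⁻¹` turns `∇` into a smooth `λ`-connection on `L`: differentiate
`ι e` and project back to `L` along the image of `σ`. For a local holomorphic frame `e` with dual
coframe `e*`, its connection form is `A = det(∇ ι e, σ e*)`, because `det(ι l, σ ξ) = ξ(l)` and the
image of `σ`, being of rank one, is isotropic for `det`. Replacing `e` by `g e` adds `λ dg/g` to
`A`, and adds the same term to `λ ∂ log |e|²` for a Hermitian metric on `L`. So `α = A - λ ∂ log
|e|²` is a global smooth `(1,0)`-form.

Now apply `∂̄`. The section `∇ ι e` is holomorphic, so only `σ` contributes; as `∂̄σ = ι β`, the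
result is `det(∇ ι e, ι β e*)`, which by skew-symmetry is `-β ∧ c`. Hence `∂̄α = -(β ∧ c + λ F)`,
where `F` is the curvature of the metric. Stokes' theorem gives `∫ β ∧ c = -λ ∫ F`, and `-1/(2πi) =
i/(2π)` turns this into the claim.

The argument is carried by `Embedding.IsExtensionClass.exists_splitting` (every representative `β`
comes from a splitting), by the transition laws `LambdaConnection.connCoeff_eq` and
`HermitianMetric.dz_logNorm`, by `LambdaConnection.dbarForm_connForm`, and by
`integral_add_eq_zero`.

Forms are encoded pointwise: a `(1,0)`-form is a function on `X`, its value at `q` being taken on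
`∂/∂z` for the preferred chart at `q`. Such a function may jump where the preferred chart changes,
so regularity is stated for `coeff` and `density`, which correct it by derivatives of transition
maps. -/

theorem dzbar_sub {f g : ℂ → G} {z : ℂ} (hf : DifferentiableAt ℝ f z)
    (hg : DifferentiableAt ℝ g z) :
    dzbar (fun w => f w - g w) z = dzbar f z - dzbar g z := by
  simp only [dzbar, fderiv_fun_sub hf hg, sub_apply]
  module

theorem dzbar_sum {κ : Type*} (s : Finset κ) {f : κ → ℂ → G} {z : ℂ}
    (hf : ∀ i ∈ s, DifferentiableAt ℝ (f i) z) :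
    dzbar (fun w => ∑ i ∈ s, f i w) z = ∑ i ∈ s, dzbar (f i) z := by
  simp only [dzbar, fderiv_fun_sum hf, sum_apply, Finset.smul_sum,
    Finset.sum_add_distrib, smul_add]

theorem dzbar_smul {f : ℂ → ℂ} {g : ℂ → G} {z : ℂ} (hf : DifferentiableAt ℝ f z)
    (hg : DifferentiableAt ℝ g z) :
    dzbar (fun w => f w • g w) z = dzbar f z • g z + f z • dzbar g z := by
  simp only [dzbar, fderiv_fun_smul hf hg, add_apply, smul_apply,
    ContinuousLinearMap.smulRight_apply, smul_eq_mul]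
  module

theorem dzbar_mul {f g : ℂ → ℂ} {z : ℂ} (hf : DifferentiableAt ℝ f z)
    (hg : DifferentiableAt ℝ g z) :
    dzbar (fun w => f w * g w) z = dzbar f z * g z + f z * dzbar g z :=
  dzbar_smul hf hg

theorem dz_add {f g : ℂ → G} {z : ℂ} (hf : DifferentiableAt ℝ f z)
    (hg : DifferentiableAt ℝ g z) :
    dz (fun w => f w + g w) z = dz f z + dz g z := by
  simp only [dz, fderiv_fun_add hf hg, add_apply]
  module

theorem dz_congr {f g : ℂ → G} {z : ℂ} (h : f =ᶠ[𝓝 z] g) : dz f z = dz g z := by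
  simp only [dz, h.fderiv_eq]

theorem dzbar_const (c : G) (z : ℂ) : dzbar (fun _ => c) z = 0 := by
  simp [dzbar]

theorem dzbar_const_mul (c : ℂ) {f : ℂ → ℂ} {z : ℂ} (hf : DifferentiableAt ℝ f z) :
    dzbar (fun w => c * f w) z = c * dzbar f z := by
  rw [dzbar_mul (differentiableAt_const c) hf, dzbar_const]
  ring

theorem fderiv_real_apply {f : ℂ → G} {z : ℂ} (hf : DifferentiableAt ℂ f z) (w : ℂ) :
    fderiv ℝ f z w = w • deriv f z := by
  rw [(hf.hasFDerivAt.restrictScalars ℝ).fderiv]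
  simp

theorem dzbar_eq_zero {f : ℂ → G} {z : ℂ} (hf : DifferentiableAt ℂ f z) : dzbar f z = 0 := by
  simp [dzbar, fderiv_real_apply hf, smul_smul]

/-- Real linearity expands any differential in `dz` and `dz̄`. A holomorphic substitution `φ`
rescales these by `φ'` and its conjugate, which is how both chain rules below follow. -/
theorem fderiv_eq_dz_add_dzbar (f : ℂ → G) (z w : ℂ) :
    fderiv ℝ f z w = w • dz f z + starRingEnd ℂ w • dzbar f z := by
  have h : fderiv ℝ f z w = w.re • fderiv ℝ f z 1 + w.im • fderiv ℝ f z Complex.I := by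
    rw [← map_smul, ← map_smul, ← map_add]
    congr 1
    simp [Complex.re_add_im]
  have h1 : w = w.re + w.im * Complex.I := (Complex.re_add_im w).symm
  have h2 : starRingEnd ℂ w = w.re - w.im * Complex.I := by
    apply Complex.ext <;> simp
  rw [h, h2]
  conv_rhs => enter [1, 1]; rw [h1]
  simp only [dz, dzbar, ← Complex.coe_smul]
  match_scalars
  · ring
  · linear_combination (w.im : ℂ) * Complex.I_sq

theorem fderiv_comp_holomorphic {f : ℂ → G} {φ : ℂ → ℂ} {z : ℂ}
    (hf : DifferentiableAt ℝ f (φ z)) (hφ : DifferentiableAt ℂ φ z) (w : ℂ) :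
    fderiv ℝ (f ∘ φ) z w = fderiv ℝ f (φ z) (w * deriv φ z) := by
  rw [fderiv_comp z hf (hφ.restrictScalars ℝ), ContinuousLinearMap.comp_apply,
    fderiv_real_apply hφ, smul_eq_mul]

theorem dzbar_comp {f : ℂ → G} {φ : ℂ → ℂ} {z : ℂ}
    (hf : DifferentiableAt ℝ f (φ z)) (hφ : DifferentiableAt ℂ φ z) :
    dzbar (f ∘ φ) z = starRingEnd ℂ (deriv φ z) • dzbar f (φ z) := by
  rw [dzbar, fderiv_comp_holomorphic hf hφ, fderiv_comp_holomorphic hf hφ,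
    fderiv_eq_dz_add_dzbar, fderiv_eq_dz_add_dzbar]
  simp only [map_mul, Complex.conj_I, one_mul]
  match_scalars
  · linear_combination (1 / 2 * deriv φ z) * Complex.I_sq
  · linear_combination (-1 / 2 * starRingEnd ℂ (deriv φ z)) * Complex.I_sq

theorem dz_comp {f : ℂ → G} {φ : ℂ → ℂ} {z : ℂ}
    (hf : DifferentiableAt ℝ f (φ z)) (hφ : DifferentiableAt ℂ φ z) :
    dz (f ∘ φ) z = deriv φ z • dz f (φ z) := by
  rw [dz, fderiv_comp_holomorphic hf hφ, fderiv_comp_holomorphic hf hφ,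
    fderiv_eq_dz_add_dzbar, fderiv_eq_dz_add_dzbar]
  simp only [map_mul, Complex.conj_I, one_mul]
  match_scalars
  · linear_combination (-1 / 2 * deriv φ z) * Complex.I_sq
  · linear_combination (1 / 2 * starRingEnd ℂ (deriv φ z)) * Complex.I_sq

theorem contDiffAt_dzbar {f : ℂ → G} {z : ℂ} (hf : ContDiffAt ℝ ∞ f z) :
    ContDiffAt ℝ ∞ (dzbar f) z := by
  have h : ContDiffAt ℝ ∞ (fderiv ℝ f) z := hf.fderiv_right (by simp)
  exact ((h.clm_apply contDiffAt_const).add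
    ((h.clm_apply contDiffAt_const).const_smul Complex.I)).const_smul (1 / 2 : ℂ)

theorem contDiffAt_dz {f : ℂ → G} {z : ℂ} (hf : ContDiffAt ℝ ∞ f z) :
    ContDiffAt ℝ ∞ (dz f) z := by
  have h : ContDiffAt ℝ ∞ (fderiv ℝ f) z := hf.fderiv_right (by simp)
  exact ((h.clm_apply contDiffAt_const).sub
    ((h.clm_apply contDiffAt_const).const_smul Complex.I)).const_smul (1 / 2 : ℂ)

/-- Locally `log |g|²` is `log g` plus its conjugate, and `∂` kills the conjugate. No branch of the
logarithm is chosen: `|g|²` is differentiated directly through the real inner product. -/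
theorem dz_log_norm_sq {g : ℂ → ℂ} {z : ℂ} (hg : DifferentiableAt ℂ g z) (h0 : g z ≠ 0) :
    dz (fun w => (Real.log (‖g w‖ ^ 2) : ℂ)) z = deriv g z / g z := by
  have hn : HasFDerivAt (fun w => ‖w‖ ^ 2) (2 • innerSL ℝ (g z)) (g z) :=
    (hasStrictFDerivAt_norm_sq (g z)).hasFDerivAt
  have hgr := hg.hasFDerivAt.restrictScalars ℝ
  have h2 : HasFDerivAt (fun w => Real.log (‖g w‖ ^ 2)) _ z :=
    (hn.comp z hgr).log (by simpa using h0)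
  have h3 := Complex.ofRealCLM.hasFDerivAt.comp z h2
  have h4 : (fun w => (Real.log (‖g w‖ ^ 2) : ℂ)) =
      Complex.ofRealCLM ∘ fun w => Real.log (‖g w‖ ^ 2) := rfl
  have hk : g z * starRingEnd ℂ (g z) = ((‖g z‖ ^ 2 : ℝ) : ℂ) := by
    rw [Complex.mul_conj, Complex.normSq_eq_norm_sq]
  have h5 : ((‖g z‖ ^ 2 : ℝ) : ℂ) ≠ 0 := by
    rw [← hk]; simpa using h0
  have hre : ∀ x : ℂ, ((inner ℝ (g z) x : ℝ) : ℂ) =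
      (starRingEnd ℂ (g z) * x + g z * starRingEnd ℂ x) / 2 := by
    intro x
    apply Complex.ext
    · simp [Complex.inner]; ring
    · simp [Complex.inner]; ring
  have h6 : ∀ w : ℂ, fderiv ℝ (fun w => (Real.log (‖g w‖ ^ 2) : ℂ)) z w =
      (starRingEnd ℂ (g z) * (w * deriv g z) + g z * starRingEnd ℂ (w * deriv g z)) /
        (g z * starRingEnd ℂ (g z)) := by
    intro w
    have h7 : fderiv ℝ (fun w => (Real.log (‖g w‖ ^ 2) : ℂ)) z w =
        (((‖g z‖ ^ 2)⁻¹ * (2 * inner ℝ (g z) (fderiv ℂ g z w)) : ℝ) : ℂ) := by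
      rw [h4, h3.fderiv]
      simp only [ContinuousLinearMap.comp_apply, smul_apply,
        ContinuousLinearMap.coe_restrictScalars', smul_eq_mul, Complex.ofRealCLM_apply,
        two_smul, add_apply, innerSL_apply_apply, Function.comp_apply, two_mul]
    have h8 : fderiv ℂ g z w = w * deriv g z := by
      rw [fderiv_eq_smul_deriv, smul_eq_mul]
    rw [h7, h8, hk]
    push_cast
    rw [hre]
    field_simp
  have h7 : starRingEnd ℂ (g z) ≠ 0 := by simpa using h0
  rw [dz, h6, h6]
  simp only [map_mul, Complex.conj_I, one_mul, smul_eq_mul]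
  field_simp
  linear_combination (-(starRingEnd ℂ (g z)) * deriv g z + g z * starRingEnd ℂ (deriv g z)) *
    Complex.I_sq

/-- Integration by parts against the constant `1`, in the directions `1` and `i`. -/
theorem integral_dzbar_eq_zero {f : ℂ → ℂ} (hf : ContDiff ℝ ∞ f) (hc : HasCompactSupport f) :
    ∫ z, dzbar f z = 0 := by
  have hcont : Continuous (fderiv ℝ f) := hf.continuous_fderiv (by simp)
  have hint : ∀ v : ℂ, Integrable (fun z => fderiv ℝ f z v) := fun v =>
    (hcont.clm_apply continuous_const).integrable_of_hasCompactSupport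
      ((hc.fderiv (𝕜 := ℝ)).comp_left (g := fun l : ℂ →L[ℝ] ℂ => l v) (by simp))
  have hz : ∀ v : ℂ, ∫ z, fderiv ℝ f z v = 0 := fun v => by
    have h := integral_smul_fderiv_eq_neg_fderiv_smul_of_integrable (𝕜 := ℝ) (v := v)
      (μ := volume) (f := fun _ : ℂ => (1 : ℝ)) (g := f) (by simp) (by simpa using hint v)
      (by simpa using hf.continuous.integrable_of_hasCompactSupport hc)
      (by simp) (fun x _ => hf.differentiable (by simp) x)
    simpa using h
  simp only [dzbar]
  have h := integral_add (hint 1) ((hint Complex.I).smul Complex.I)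
  simp only [Pi.smul_apply] at h
  rw [integral_smul, h, integral_smul, hz, hz]
  simp

end Wirtinger

/-! ### Forms in coordinates -/

section Coordinates

open MeasureTheory

variable {X : Type*} [TopologicalSpace X] [ChartedSpace ℂ X]

/-- The component at `q` of the coordinate vector field `∂/∂z` of the chart around `p`. -/
def coordDeriv (p q : X) : ℂ := deriv (chartAt ℂ q ∘ (chartAt ℂ p).symm) (chartAt ℂ p q)

/-- The coefficient, in the chart around `p`, of the `(1,0)`-form which takes at each `q` the value
`α q` on the coordinate vector of the chart around `q`. -/
def coeff (α : X → ℂ) (p : X) (z : ℂ) : ℂ :=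
  α ((chartAt ℂ p).symm z) * coordDeriv p ((chartAt ℂ p).symm z)

/-- The coefficient, in the chart around `p`, of the `(1,1)`-form with the coefficient `μ q` at `q`
in the chart around `q`. -/
def density (μ : X → ℂ) (p : X) (z : ℂ) : ℂ :=
  μ ((chartAt ℂ p).symm z) * (starRingEnd ℂ (coordDeriv p ((chartAt ℂ p).symm z)) *
    coordDeriv p ((chartAt ℂ p).symm z))

/-- Smoothness of the `(1,0)`-form with the coefficients `α`. -/
def SmoothForm (α : X → ℂ) : Prop := ∀ q, ContDiffAt ℝ ∞ (coeff α q) (chartAt ℂ q q)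

/-- The coefficient at `q`, in the chart around `q`, of `∂̄` of a `(1,0)`-form. -/
def dbarForm (α : X → ℂ) (q : X) : ℂ := dzbar (coeff α q) (chartAt ℂ q q)

/-- The coefficient at `q`, in the chart around `q`, of `∂̄` of a function. -/
def dbarFun (f : X → ℂ) (q : X) : ℂ := dzbar (f ∘ (chartAt ℂ q).symm) (chartAt ℂ q q)

/-- Smoothness of a function in every chart. -/
def SmoothFun (f : X → ℂ) : Prop :=
  ∀ p, ∀ z ∈ (chartAt ℂ p).target, ContDiffAt ℝ ∞ (f ∘ (chartAt ℂ p).symm) z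

theorem coordDeriv_self (q : X) : coordDeriv q q = 1 := by
  have h : chartAt ℂ q ∘ (chartAt ℂ q).symm =ᶠ[𝓝 (chartAt ℂ q q)] id := by
    filter_upwards [(chartAt ℂ q).open_target.mem_nhds (mem_chart_target ℂ q)] with z hz
    exact (chartAt ℂ q).right_inv hz
  rw [coordDeriv, h.deriv_eq, deriv_id]

variable [IsManifold 𝓘(ℂ) ω X]

/-! ### Transition maps and change of coordinates. -/

theorem transition_contDiffAt {p q x : X} (hp : x ∈ (chartAt ℂ p).source)
    (hq : x ∈ (chartAt ℂ q).source) :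
    ContDiffAt ℂ ω (chartAt ℂ q ∘ (chartAt ℂ p).symm) (chartAt ℂ p x) := by
  have h := contDiffWithinAt_ext_coord_change (I := 𝓘(ℂ)) (n := ω) q p (y := chartAt ℂ p x) (by
    simp [hp, hq])
  exact contDiffWithinAt_univ.1 (by simpa using h)

theorem transition_differentiableAt {p q x : X} (hp : x ∈ (chartAt ℂ p).source)
    (hq : x ∈ (chartAt ℂ q).source) :
    DifferentiableAt ℂ (chartAt ℂ q ∘ (chartAt ℂ p).symm) (chartAt ℂ p x) :=
  (transition_contDiffAt hp hq).differentiableAt (by simp)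

theorem transition_comp {p q r x : X} (hp : x ∈ (chartAt ℂ p).source)
    (hq : x ∈ (chartAt ℂ q).source) (hr : x ∈ (chartAt ℂ r).source) :
    deriv (chartAt ℂ r ∘ (chartAt ℂ p).symm) (chartAt ℂ p x) =
      deriv (chartAt ℂ r ∘ (chartAt ℂ q).symm) (chartAt ℂ q x) *
        deriv (chartAt ℂ q ∘ (chartAt ℂ p).symm) (chartAt ℂ p x) := by
  have hx : (chartAt ℂ q ∘ (chartAt ℂ p).symm) (chartAt ℂ p x) = chartAt ℂ q x := by
    simp [(chartAt ℂ p).left_inv hp]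
  have h1 := transition_differentiableAt hq hr
  rw [← hx] at h1
  have h := deriv_comp _ h1 (transition_differentiableAt hp hq)
  rw [hx] at h
  rw [← h]
  refine Filter.EventuallyEq.deriv_eq ?_
  have hc := (chartAt ℂ p).continuousAt_symm ((chartAt ℂ p).map_source hp)
  rw [ContinuousAt, (chartAt ℂ p).left_inv hp] at hc
  filter_upwards [hc.eventually ((chartAt ℂ q).open_source.mem_nhds hq)] with z hz
  simp [(chartAt ℂ q).left_inv hz]

theorem coordDeriv_eq {p q x : X} (hp : x ∈ (chartAt ℂ p).source)
    (hq : x ∈ (chartAt ℂ q).source) :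
    coordDeriv p x = coordDeriv q x * deriv (chartAt ℂ q ∘ (chartAt ℂ p).symm) (chartAt ℂ p x) :=
  transition_comp hp hq (mem_chart_source ℂ x)

theorem deriv_transition_mul_coordDeriv {p x : X} (hp : x ∈ (chartAt ℂ p).source) :
    deriv (chartAt ℂ p ∘ (chartAt ℂ x).symm) (chartAt ℂ x x) * coordDeriv p x = 1 := by
  rw [coordDeriv, ← transition_comp hp (mem_chart_source ℂ x) hp]
  have h : chartAt ℂ p ∘ (chartAt ℂ p).symm =ᶠ[𝓝 (chartAt ℂ p x)] id := by
    filter_upwards [(chartAt ℂ p).open_target.mem_nhds ((chartAt ℂ p).map_source hp)] with z hz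
    exact (chartAt ℂ p).right_inv hz
  rw [h.deriv_eq, deriv_id]

/-- The tangent space at `x` is `ℂ` by means of the chart at `x`, so the coordinate change of the
tangent bundle from `p` to `x` is multiplication by the derivative of the transition map. -/
theorem coordVec_eq {p x : X} (hp : x ∈ (chartAt ℂ p).source) (w : ℂ) :
    coordVec p x w = (w * coordDeriv p x : ℂ) := by
  have h := TangentBundle.symmL_trivializationAt_eq_core (I := 𝓘(ℂ)) (b₀ := p) (b := x) hp
  have h1 := DFunLike.congr_fun h w
  refine ((trivializationAt ℂ (TangentSpace 𝓘(ℂ) : X → Type _) p).symmL_apply (R := ℂ)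
    hp w).symm.trans (h1.trans ?_)
  rw [tangentBundleCore_coordChange_achart]
  simp only [coordDeriv, mfld_simps, fderivWithin_univ]
  exact fderiv_eq_smul_deriv (F := ℂ) (𝕜 := ℂ) w

theorem coeff_eventuallyEq (α : X → ℂ) {p x : X} (hp : x ∈ (chartAt ℂ p).source) :
    coeff α p =ᶠ[𝓝 (chartAt ℂ p x)] fun z =>
      coeff α x ((chartAt ℂ x ∘ (chartAt ℂ p).symm) z) *
        deriv (chartAt ℂ x ∘ (chartAt ℂ p).symm) z := by
  have hc := (chartAt ℂ p).continuousAt_symm ((chartAt ℂ p).map_source hp)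
  rw [ContinuousAt, (chartAt ℂ p).left_inv hp] at hc
  filter_upwards [hc.eventually ((chartAt ℂ x).open_source.mem_nhds (mem_chart_source ℂ x)),
    (chartAt ℂ p).open_target.mem_nhds ((chartAt ℂ p).map_source hp)] with z hz hz'
  have h := coordDeriv_eq ((chartAt ℂ p).map_target hz') hz
  rw [(chartAt ℂ p).right_inv hz'] at h
  simp only [coeff, Function.comp_apply, (chartAt ℂ x).left_inv hz]
  rw [h, mul_assoc]

/-- `SmoothForm` asks for smoothness only at the centre of each chart. Near another point, the
coefficient is that of the chart centred there, composed with a holomorphic transition map and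
multiplied by its derivative. -/
theorem coeff_contDiffAt {α : X → ℂ} (hα : SmoothForm α) {p : X} {z : ℂ}
    (hz : z ∈ (chartAt ℂ p).target) : ContDiffAt ℝ ∞ (coeff α p) z := by
  obtain ⟨x, hp, rfl⟩ : ∃ x ∈ (chartAt ℂ p).source, chartAt ℂ p x = z :=
    ⟨_, (chartAt ℂ p).map_target hz, (chartAt ℂ p).right_inv hz⟩
  refine ContDiffAt.congr_of_eventuallyEq ?_ (coeff_eventuallyEq α hp)
  have h := transition_contDiffAt hp (mem_chart_source ℂ x)
  have hx : (chartAt ℂ x ∘ (chartAt ℂ p).symm) (chartAt ℂ p x) = chartAt ℂ x x := by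
    simp [(chartAt ℂ p).left_inv hp]
  refine ContDiffAt.mul ?_ ?_
  · refine ContDiffAt.comp _ (g := coeff α x) ?_ ((h.restrict_scalars ℝ).of_le le_top)
    rw [hx]
    exact hα x
  · have h1 : ContDiffAt ℂ ∞ (fderiv ℂ (chartAt ℂ x ∘ (chartAt ℂ p).symm)) (chartAt ℂ p x) :=
      h.fderiv_right (by simp)
    exact ((h1.clm_apply contDiffAt_const).restrict_scalars ℝ)

/-- The derivative of the transition map is holomorphic, so `∂̄` passes over it; the only new factor
is its conjugate, from the chain rule. Thus `∂̄` of a `(1,0)`-form does not depend on the chart. -/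
theorem dzbar_coeff {α : X → ℂ} (hα : SmoothForm α) {p : X} {z : ℂ}
    (hz : z ∈ (chartAt ℂ p).target) : dzbar (coeff α p) z = density (dbarForm α) p z := by
  obtain ⟨x, hp, rfl⟩ : ∃ x ∈ (chartAt ℂ p).source, chartAt ℂ p x = z :=
    ⟨_, (chartAt ℂ p).map_target hz, (chartAt ℂ p).right_inv hz⟩
  have h := transition_contDiffAt hp (mem_chart_source ℂ x)
  have hd := transition_differentiableAt hp (mem_chart_source ℂ x)
  have hx : (chartAt ℂ x ∘ (chartAt ℂ p).symm) (chartAt ℂ p x) = chartAt ℂ x x := by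
    simp [(chartAt ℂ p).left_inv hp]
  have h1 : ContDiffAt ℂ ∞ (fderiv ℂ (chartAt ℂ x ∘ (chartAt ℂ p).symm)) (chartAt ℂ p x) :=
    h.fderiv_right (by simp)
  have h2 : DifferentiableAt ℂ (deriv (chartAt ℂ x ∘ (chartAt ℂ p).symm)) (chartAt ℂ p x) :=
    (h1.clm_apply contDiffAt_const).differentiableAt (by simp)
  have h3 : DifferentiableAt ℝ (coeff α x)
      ((chartAt ℂ x ∘ (chartAt ℂ p).symm) (chartAt ℂ p x)) := by
    rw [hx]; exact (hα x).differentiableAt (by simp)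
  rw [dzbar_congr (coeff_eventuallyEq α hp)]
  have h4 := dzbar_mul (f := coeff α x ∘ (chartAt ℂ x ∘ (chartAt ℂ p).symm))
    (h3.comp _ (hd.restrictScalars ℝ)) (h2.restrictScalars ℝ)
  refine h4.trans ?_
  rw [dzbar_eq_zero h2, dzbar_comp h3 hd, hx, density, (chartAt ℂ p).left_inv hp, dbarForm,
    smul_eq_mul, coordDeriv]
  ring

theorem dzbar_comp_chart {f : X → ℂ} (hf : SmoothFun f) {p : X} {z : ℂ}
    (hz : z ∈ (chartAt ℂ p).target) :
    dzbar (f ∘ (chartAt ℂ p).symm) z =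
      dbarFun f ((chartAt ℂ p).symm z) *
        starRingEnd ℂ (coordDeriv p ((chartAt ℂ p).symm z)) := by
  obtain ⟨x, hp, rfl⟩ : ∃ x ∈ (chartAt ℂ p).source, chartAt ℂ p x = z :=
    ⟨_, (chartAt ℂ p).map_target hz, (chartAt ℂ p).right_inv hz⟩
  have hd := transition_differentiableAt hp (mem_chart_source ℂ x)
  have hx : (chartAt ℂ x ∘ (chartAt ℂ p).symm) (chartAt ℂ p x) = chartAt ℂ x x := by
    simp [(chartAt ℂ p).left_inv hp]
  have hev : f ∘ (chartAt ℂ p).symm =ᶠ[𝓝 (chartAt ℂ p x)]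
      (f ∘ (chartAt ℂ x).symm) ∘ (chartAt ℂ x ∘ (chartAt ℂ p).symm) := by
    have hc := (chartAt ℂ p).continuousAt_symm ((chartAt ℂ p).map_source hp)
    rw [ContinuousAt, (chartAt ℂ p).left_inv hp] at hc
    filter_upwards [hc.eventually ((chartAt ℂ x).open_source.mem_nhds (mem_chart_source ℂ x))]
      with z hz
    simp [(chartAt ℂ x).left_inv hz]
  have h3 : DifferentiableAt ℝ (f ∘ (chartAt ℂ x).symm)
      ((chartAt ℂ x ∘ (chartAt ℂ p).symm) (chartAt ℂ p x)) := by
    rw [hx]; exact (hf x _ (mem_chart_target ℂ x)).differentiableAt (by simp)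
  rw [dzbar_congr hev, dzbar_comp h3 hd, hx, (chartAt ℂ p).left_inv hp, smul_eq_mul, mul_comm]
  rfl

/-- The real determinant of multiplication by `a` is the norm of `a` from `ℂ` to `ℝ`. This Jacobian
is the factor by which `density` transforms. -/
theorem abs_det_eq_normSq (a : ℂ) (f' : ℂ →L[ℝ] ℂ) (h : ∀ w, f' w = w * a) :
    |f'.det| = Complex.normSq a := by
  have h1 : (f' : ℂ →ₗ[ℝ] ℂ) = LinearMap.mulLeft ℝ a := LinearMap.ext fun w => by
    simp [h, mul_comm]
  have h3 : LinearMap.det (LinearMap.mulLeft ℝ a) = Algebra.norm ℝ a := by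
    rw [Algebra.norm_apply]; rfl
  rw [ContinuousLinearMap.det, h1, h3, Algebra.norm_complex_apply]
  exact abs_of_nonneg (Complex.normSq_nonneg a)

/-- Change of variables: the integral of a `(1,1)`-form supported in two charts. -/
theorem integral_density_eq {p q : X} {μ : X → ℂ}
    (hμ : ∀ x, μ x ≠ 0 → x ∈ (chartAt ℂ p).source ∧ x ∈ (chartAt ℂ q).source) :
    ∫ z in (chartAt ℂ p).target, density μ p z = ∫ z in (chartAt ℂ q).target, density μ q z := by
  set e := (chartAt ℂ p).symm.trans (chartAt ℂ q) with he
  have hs : ∀ z, z ∈ e.source ↔ z ∈ (chartAt ℂ p).target ∧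
      (chartAt ℂ p).symm z ∈ (chartAt ℂ q).source := fun z => by simp [he]
  have ht : ∀ z, z ∈ e.target ↔ z ∈ (chartAt ℂ q).target ∧
      (chartAt ℂ q).symm z ∈ (chartAt ℂ p).source := fun z => by simp [he]
  -- The form vanishes off the overlap of the two charts, so both integrals reduce to the domain and
  -- range of the transition map.
  have h1 : ∫ z in (chartAt ℂ p).target, density μ p z = ∫ z in e.source, density μ p z := by
    refine setIntegral_eq_of_subset_of_forall_sdiff_eq_zero
      (chartAt ℂ p).open_target.measurableSet (fun z hz => ((hs z).1 hz).1) fun z hz => ?_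
    by_contra h0
    have h2 : μ ((chartAt ℂ p).symm z) ≠ 0 := fun h => h0 (by simp [density, h])
    exact hz.2 ((hs z).2 ⟨hz.1, (hμ _ h2).2⟩)
  have h2 : ∫ z in (chartAt ℂ q).target, density μ q z = ∫ z in e.target, density μ q z := by
    refine setIntegral_eq_of_subset_of_forall_sdiff_eq_zero
      (chartAt ℂ q).open_target.measurableSet (fun z hz => ((ht z).1 hz).1) fun z hz => ?_
    by_contra h0
    have h2 : μ ((chartAt ℂ q).symm z) ≠ 0 := fun h => h0 (by simp [density, h])
    exact hz.2 ((ht z).2 ⟨hz.1, (hμ _ h2).1⟩)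
  have hd : ∀ z ∈ e.source, DifferentiableAt ℂ e z := fun z hz => by
    have h := transition_differentiableAt ((chartAt ℂ p).map_target ((hs z).1 hz).1)
      ((hs z).1 hz).2
    rwa [(chartAt ℂ p).right_inv ((hs z).1 hz).1] at h
  rw [h1, h2, ← e.image_source_eq_target,
    integral_image_eq_integral_abs_det_fderiv_smul volume e.open_source.measurableSet
      (fun z hz => ((hd z hz).hasFDerivAt.restrictScalars ℝ).hasFDerivWithinAt) e.injOn]
  refine setIntegral_congr_fun e.open_source.measurableSet fun z hz => ?_
  have h3 := coordDeriv_eq ((chartAt ℂ p).map_target ((hs z).1 hz).1) ((hs z).1 hz).2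
  rw [(chartAt ℂ p).right_inv ((hs z).1 hz).1] at h3
  have h4 : (chartAt ℂ q).symm (e z) = (chartAt ℂ p).symm z := by
    simp [he, (chartAt ℂ q).left_inv ((hs z).1 hz).2]
  rw [abs_det_eq_normSq (deriv e z) _ (fun w => by simp [fderiv_eq_smul_deriv])]
  simp only [density]
  rw [h4, h3, Complex.real_smul, ← Complex.mul_conj, map_mul]
  have h5 : deriv (chartAt ℂ q ∘ (chartAt ℂ p).symm) z = deriv e z := rfl
  rw [h5]
  ring

theorem integrableOn_of_support {p : X} {K : Set X} (hK : IsCompact K)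
    (hKp : K ⊆ (chartAt ℂ p).source) {g : ℂ → ℂ}
    (hg : ContinuousOn g (chartAt ℂ p).target)
    (h0 : ∀ z ∈ (chartAt ℂ p).target, g z ≠ 0 → (chartAt ℂ p).symm z ∈ K) :
    IntegrableOn g (chartAt ℂ p).target := by
  have hK' : IsCompact (chartAt ℂ p '' K) :=
    hK.image_of_continuousOn ((chartAt ℂ p).continuousOn.mono hKp)
  have hsub : chartAt ℂ p '' K ⊆ (chartAt ℂ p).target := by
    rintro _ ⟨x, hx, rfl⟩
    exact (chartAt ℂ p).map_source (hKp hx)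
  refine ((hg.mono hsub).integrableOn_compact hK').of_forall_sdiff_eq_zero
    (chartAt ℂ p).open_target.measurableSet fun z hz => ?_
  by_contra h
  exact hz.2 ⟨_, h0 z hz.1 h, (chartAt ℂ p).right_inv hz.1⟩

end Coordinates

/-! ### Stokes' theorem -/

section Stokes

open MeasureTheory

variable {X : Type*} [TopologicalSpace X] [ChartedSpace ℂ X] [IsManifold 𝓘(ℂ) ω X]

/-- Continuity of the `(1,1)`-form with the coefficients `μ`. -/
def ContForm (μ : X → ℂ) : Prop := ∀ p, ContinuousOn (density μ p) (chartAt ℂ p).target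

theorem density_eventuallyEq (μ : X → ℂ) {p x : X} (hp : x ∈ (chartAt ℂ p).source) :
    density μ p =ᶠ[𝓝 (chartAt ℂ p x)] fun z =>
      density μ x ((chartAt ℂ x ∘ (chartAt ℂ p).symm) z) *
        (starRingEnd ℂ (deriv (chartAt ℂ x ∘ (chartAt ℂ p).symm) z) *
          deriv (chartAt ℂ x ∘ (chartAt ℂ p).symm) z) := by
  have hc := (chartAt ℂ p).continuousAt_symm ((chartAt ℂ p).map_source hp)
  rw [ContinuousAt, (chartAt ℂ p).left_inv hp] at hc
  filter_upwards [hc.eventually ((chartAt ℂ x).open_source.mem_nhds (mem_chart_source ℂ x)),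
    (chartAt ℂ p).open_target.mem_nhds ((chartAt ℂ p).map_source hp)] with z hz hz'
  have h := coordDeriv_eq ((chartAt ℂ p).map_target hz') hz
  rw [(chartAt ℂ p).right_inv hz'] at h
  simp only [density, Function.comp_apply, (chartAt ℂ x).left_inv hz]
  rw [h, map_mul]
  ring

/-- Under a transition map `φ` the density acquires the continuous factor `|φ'|²`, so continuity at
the centres spreads over whole charts. -/
theorem contForm_of_center {μ : X → ℂ}
    (hμ : ∀ q, ContinuousAt (density μ q) (chartAt ℂ q q)) : ContForm μ := by
  intro p z hz
  obtain ⟨x, hp, rfl⟩ : ∃ x ∈ (chartAt ℂ p).source, chartAt ℂ p x = z :=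
    ⟨_, (chartAt ℂ p).map_target hz, (chartAt ℂ p).right_inv hz⟩
  refine ContinuousAt.continuousWithinAt
    (ContinuousAt.congr ?_ (density_eventuallyEq μ hp).symm)
  have h := transition_contDiffAt hp (mem_chart_source ℂ x)
  have hx : (chartAt ℂ x ∘ (chartAt ℂ p).symm) (chartAt ℂ p x) = chartAt ℂ x x := by
    simp [(chartAt ℂ p).left_inv hp]
  have h1 : ContDiffAt ℂ ∞ (fderiv ℂ (chartAt ℂ x ∘ (chartAt ℂ p).symm)) (chartAt ℂ p x) :=
    h.fderiv_right (by simp)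
  have h2 : ContinuousAt (deriv (chartAt ℂ x ∘ (chartAt ℂ p).symm)) (chartAt ℂ p x) :=
    (h1.clm_apply contDiffAt_const).continuousAt
  have h3 := hμ x
  rw [← hx] at h3
  exact (h3.comp (f := chartAt ℂ x ∘ (chartAt ℂ p).symm) h.continuousAt).mul
    ((Complex.continuous_conj.continuousAt.comp h2).mul h2)

theorem contForm_dbarForm {α : X → ℂ} (hα : SmoothForm α) : ContForm (dbarForm α) := by
  intro p
  refine ContinuousOn.congr (f := dzbar (coeff α p)) (fun z hz => ?_)
    (fun z hz => (dzbar_coeff hα hz).symm)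
  exact (contDiffAt_dzbar (coeff_contDiffAt hα hz)).continuousAt.continuousWithinAt

theorem dzbar_comp_mul_coeff {f α : X → ℂ} (hf : SmoothFun f) {p : X} {z : ℂ}
    (hz : z ∈ (chartAt ℂ p).target) :
    dzbar (f ∘ (chartAt ℂ p).symm) z * coeff α p z =
      density (fun x => dbarFun f x * α x) p z := by
  rw [dzbar_comp_chart hf hz, coeff, density]
  ring

theorem contForm_dbarFun_mul {f α : X → ℂ} (hf : SmoothFun f) (hα : SmoothForm α) :
    ContForm (fun x => dbarFun f x * α x) := by
  intro p
  refine ContinuousOn.congr (f := fun z => dzbar (f ∘ (chartAt ℂ p).symm) z * coeff α p z)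
    (fun z hz => ?_) (fun z hz => (dzbar_comp_mul_coeff hf hz).symm)
  exact ((contDiffAt_dzbar (hf p z hz)).continuousAt.mul
    (coeff_contDiffAt hα hz).continuousAt).continuousWithinAt

theorem ContForm.mul {f μ : X → ℂ} (hf : Continuous f) (hμ : ContForm μ) :
    ContForm (fun x => f x * μ x) := by
  intro p
  refine ContinuousOn.congr (f := fun z => f ((chartAt ℂ p).symm z) * density μ p z)
    (ContinuousOn.mul ?_ (hμ p)) (fun z _ => by simp only [density]; ring)
  exact hf.comp_continuousOn (chartAt ℂ p).continuousOn_symm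

theorem dbarFun_eq_zero {f : X → ℂ} {x : X} (hx : x ∉ tsupport f) : dbarFun f x = 0 := by
  have h := chart_eventually (notMem_tsupport_iff_eventuallyEq.1 hx)
  rw [dbarFun, dzbar_congr h]
  exact dzbar_const (0 : ℂ) _

variable [CompactSpace X]

theorem ContForm.integrableOn {μ : X → ℂ} (hμ : ContForm μ) {p : X} {f : X → ℂ}
    (hf : tsupport f ⊆ (chartAt ℂ p).source) (h0 : ∀ x, μ x ≠ 0 → x ∈ tsupport f) :
    IntegrableOn (density μ p) (chartAt ℂ p).target :=
  integrableOn_of_support (isClosed_tsupport f).isCompact hf (hμ p) fun z _ hz =>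
    h0 _ fun h => hz (by simp [density, h])

/-- Stokes' theorem for a form supported in a chart. -/
theorem integral_density_dbar_eq_zero {f α : X → ℂ} (hf : SmoothFun f) (hα : SmoothForm α)
    {p : X} (hp : tsupport f ⊆ (chartAt ℂ p).source) :
    ∫ z in (chartAt ℂ p).target,
      (density (fun x => dbarFun f x * α x) p z + density (fun x => f x * dbarForm α x) p z) =
      0 := by
  set T := (chartAt ℂ p).target with hT
  -- The coefficient of `f α` extended by zero; it is smooth on all of `ℂ` because its support lies
  -- in a compact subset of the chart target.
  set g : ℂ → ℂ := T.indicator fun z => (f ∘ (chartAt ℂ p).symm) z * coeff α p z with hg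
  set K := chartAt ℂ p '' tsupport f with hK
  have hKc : IsCompact K :=
    (isClosed_tsupport f).isCompact.image_of_continuousOn ((chartAt ℂ p).continuousOn.mono hp)
  have hKT : K ⊆ T := by
    rintro _ ⟨x, hx, rfl⟩
    exact (chartAt ℂ p).map_source (hp hx)
  have hgK : ∀ z ∉ K, g z = 0 := by
    intro z hz
    by_cases hzT : z ∈ T
    · rw [hg, Set.indicator_of_mem hzT]
      have : f ((chartAt ℂ p).symm z) = 0 := by
        by_contra h
        exact hz ⟨_, subset_tsupport _ h, (chartAt ℂ p).right_inv hzT⟩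
      simp [this]
    · rw [hg, Set.indicator_of_notMem hzT]
  have hgev : ∀ z ∈ T, g =ᶠ[𝓝 z] fun z => (f ∘ (chartAt ℂ p).symm) z * coeff α p z := by
    intro z hz
    filter_upwards [(chartAt ℂ p).open_target.mem_nhds hz] with w hw
    exact Set.indicator_of_mem hw _
  have hgs : ContDiff ℝ ∞ g := by
    rw [contDiff_iff_contDiffAt]
    intro z
    by_cases hz : z ∈ T
    · exact ((hf p z hz).mul (coeff_contDiffAt hα hz)).congr_of_eventuallyEq (hgev z hz)
    · refine (contDiffAt_const (c := (0 : ℂ))).congr_of_eventuallyEq ?_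
      filter_upwards [hKc.isClosed.isOpen_compl.mem_nhds fun h => hz (hKT h)] with w hw
      exact hgK w hw
  have hgc : HasCompactSupport g := HasCompactSupport.intro hKc hgK
  rw [← integral_dzbar_eq_zero hgs hgc, ← setIntegral_univ (f := fun z => dzbar g z),
    setIntegral_eq_of_subset_of_forall_sdiff_eq_zero MeasurableSet.univ (Set.subset_univ T)]
  · refine setIntegral_congr_fun (chartAt ℂ p).open_target.measurableSet fun z hz => ?_
    rw [dzbar_congr (hgev z hz), dzbar_mul ((hf p z hz).differentiableAt (by simp))
      ((coeff_contDiffAt hα hz).differentiableAt (by simp)), dzbar_comp_mul_coeff hf hz,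
      dzbar_coeff hα hz]
    simp only [density, Function.comp_apply]
    ring
  · intro z hz
    have h : g =ᶠ[𝓝 z] fun _ => 0 := by
      filter_upwards [hKc.isClosed.isOpen_compl.mem_nhds fun h => hz.2 (hKT h)] with w hw
      exact hgK w hw
    rw [dzbar_congr h, dzbar_const]

variable [T2Space X]

theorem smoothFun_of_contMDiff {f : X → ℂ} (hf : ContMDiff 𝓘(ℝ, ℂ) 𝓘(ℝ, ℂ) ∞ f) :
    SmoothFun f := by
  have : IsManifold 𝓘(ℝ, ℂ) ∞ X := isManifold_real
  intro p z hz
  have h := (contMDiffOn_chart_symm (I := 𝓘(ℝ, ℂ)) (n := ∞) (x := p)).contMDiffAt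
    ((chartAt ℂ p).open_target.mem_nhds hz)
  exact (hf.contMDiffAt.comp z h).contDiffAt

/-! ### The partition of unity and global integrals. -/

variable (X) in
/-- The functions of the partition of unity, with complex values. -/
def partFun (p x : X) : ℂ := (partitionOfUnity X p x : ℂ)

theorem partFun_smooth (p : X) : SmoothFun (partFun X p) := by
  refine smoothFun_of_contMDiff ?_
  exact Complex.ofRealCLM.contMDiff.comp (partitionOfUnity X p).contMDiff

theorem partFun_continuous (p : X) : Continuous (partFun X p) :=
  Complex.continuous_ofReal.comp (partitionOfUnity X p).contMDiff.continuous

theorem tsupport_partFun (p : X) : tsupport (partFun X p) ⊆ (chartAt ℂ p).source := by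
  have : IsManifold 𝓘(ℝ, ℂ) ∞ X := isManifold_real
  have h := (SmoothPartitionOfUnity.exists_isSubordinate_chartAt_source 𝓘(ℝ, ℂ) X).choose_spec p
  refine subset_trans (closure_mono fun x hx => ?_) h
  intro h0
  have h1 : partitionOfUnity X p x = 0 := h0
  exact hx (by simp [partFun, h1])

variable (X) in
theorem exists_partFun_finset : ∃ s : Finset X, (∀ p, p ∉ s → ∀ x, partFun X p x = 0) ∧
    ∀ x, ∑ p ∈ s, partFun X p x = 1 := by
  have hfin := (partitionOfUnity X).locallyFinite.finite_nonempty_of_compact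
  have h0 : ∀ p, p ∉ hfin.toFinset → ∀ x, partitionOfUnity X p x = 0 := by
    intro p hp x
    by_contra h
    exact hp (by simpa using fun h' => h (congrFun h' x))
  refine ⟨hfin.toFinset, fun p hp x => by simp [partFun, h0 p hp x], fun x => ?_⟩
  have h := (partitionOfUnity X).sum_eq_one (Set.mem_univ x)
  rw [finsum_eq_sum_of_support_subset (s := hfin.toFinset)] at h
  · simp only [partFun]
    rw [← Complex.ofReal_sum, h, Complex.ofReal_one]
  · intro p hp
    by_contra hps
    exact hp (h0 p hps x)

/-- The constant is that of `dz̄ ∧ dz = 2i dx ∧ dy`: on the vectors `a` and `i a`, with `a` the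
value of `coordDeriv`, the bracket is `2i |a|²`. -/
theorem integral_eq_sum {s : Finset X} (hs : ∀ p, p ∉ s → ∀ x, partFun X p x = 0)
    {η : Π p : X, TangentSpace 𝓘(ℂ) p → TangentSpace 𝓘(ℂ) p → ℂ} {m : X → ℂ}
    (hη : ∀ (q : X) (v w : ℂ), η q v w = m q * (starRingEnd ℂ v * w - starRingEnd ℂ w * v)) :
    integral η = 2 * Complex.I * ∑ p ∈ s, ∫ z in (chartAt ℂ p).target,
      density (fun x => partFun X p x * m x) p z := by
  rw [integral, finsum_eq_sum_of_support_subset (s := s), Finset.mul_sum]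
  · refine Finset.sum_congr rfl fun p _ => ?_
    rw [← MeasureTheory.integral_const_mul]
    refine setIntegral_congr_fun (chartAt ℂ p).open_target.measurableSet fun z hz => ?_
    have hz' := (chartAt ℂ p).map_target hz
    have h1 := hη ((chartAt ℂ p).symm z) (coordVec p ((chartAt ℂ p).symm z) 1)
      (coordVec p ((chartAt ℂ p).symm z) Complex.I)
    refine (congrArg _ h1).trans ?_
    rw [coordVec_eq hz', coordVec_eq hz']
    simp only [density, partFun, map_mul, Complex.conj_I, map_one]
    ring
  · intro p hp
    by_contra hps
    refine hp ?_
    have : ∀ x, (partitionOfUnity X p x : ℂ) = 0 := hs p hps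
    simp [this]

theorem integral_const_mul (a : ℂ)
    (η : Π p : X, TangentSpace 𝓘(ℂ) p → TangentSpace 𝓘(ℂ) p → ℂ) :
    integral (fun p v w => a * η p v w) = a * integral η := by
  simp only [integral]
  rw [← smul_eq_mul a, smul_finsum]
  refine finsum_congr fun p => ?_
  rw [smul_eq_mul, ← MeasureTheory.integral_const_mul]
  congr 1
  ext z
  ring

theorem sum_dbarFun_eq_zero {s : Finset X} (hs : ∀ x, ∑ p ∈ s, partFun X p x = 1) (x : X) :
    ∑ p ∈ s, dbarFun (partFun X p) x = 0 := by
  simp only [dbarFun]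
  rw [← dzbar_sum s fun p _ =>
    (partFun_smooth p x _ (mem_chart_target ℂ x)).differentiableAt (by simp)]
  simp only [Function.comp_apply, hs]
  exact dzbar_const _ _

/-- Stokes' theorem. -/
theorem sum_integral_dbarForm_eq_zero {s : Finset X}
    (hs1 : ∀ x, ∑ p ∈ s, partFun X p x = 1) {α : X → ℂ} (hα : SmoothForm α) :
    ∑ p ∈ s, ∫ z in (chartAt ℂ p).target,
      density (fun x => partFun X p x * dbarForm α x) p z = 0 := by
  have hc : ∀ p, ContForm fun x => dbarFun (partFun X p) x * α x := fun p =>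
    contForm_dbarFun_mul (partFun_smooth p) hα
  -- Stokes' theorem for `ρ_p α` in the chart around `p` moves `∂̄` from `α` to `ρ_p`.
  have h1 : ∀ p, ∫ z in (chartAt ℂ p).target,
      density (fun x => partFun X p x * dbarForm α x) p z =
      -∫ z in (chartAt ℂ p).target, density (fun x => dbarFun (partFun X p) x * α x) p z := by
    intro p
    rw [eq_neg_iff_add_eq_zero, add_comm, ← integral_add]
    · exact integral_density_dbar_eq_zero (partFun_smooth p) hα (tsupport_partFun p)
    · refine (hc p).integrableOn (tsupport_partFun p) fun x hx => ?_
      by_contra h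
      exact hx (by simp [dbarFun_eq_zero h])
    · refine ((contForm_dbarForm hα).mul (partFun_continuous p)).integrableOn
        (tsupport_partFun p) fun x hx => subset_tsupport _ fun h => hx (by simp [h])
  have hint : ∀ p q r, (r = p ∨ r = q) → IntegrableOn (density (fun x => partFun X q x *
      (dbarFun (partFun X p) x * α x)) r) (chartAt ℂ r).target := by
    rintro p q r (rfl | rfl)
    · refine ((hc r).mul (partFun_continuous q)).integrableOn (tsupport_partFun r) fun x hx => ?_
      by_contra h
      exact hx (by simp [dbarFun_eq_zero h])
    · exact ((hc p).mul (partFun_continuous r)).integrableOn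
        (tsupport_partFun r) fun x hx => subset_tsupport _ fun h => hx (by simp [h])
  -- The partition is inserted a second time and each piece `ρ_q ∂̄ρ_p ∧ α` is carried to the chart
  -- around `q`, so that the sum over `p` can be taken inside one chart.
  have h2 : ∀ p, ∫ z in (chartAt ℂ p).target,
      density (fun x => dbarFun (partFun X p) x * α x) p z =
      ∑ q ∈ s, ∫ z in (chartAt ℂ q).target,
        density (fun x => partFun X q x * (dbarFun (partFun X p) x * α x)) q z := by
    intro p
    have h3 : ∀ q ∈ s, ∫ z in (chartAt ℂ q).target,
        density (fun x => partFun X q x * (dbarFun (partFun X p) x * α x)) q z =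
        ∫ z in (chartAt ℂ p).target,
        density (fun x => partFun X q x * (dbarFun (partFun X p) x * α x)) p z := by
      intro q _
      refine integral_density_eq fun x hx => ⟨?_, ?_⟩
      · exact tsupport_partFun q (subset_tsupport _ fun h => hx (by simp [h]))
      · refine tsupport_partFun p ?_
        by_contra h
        exact hx (by simp [dbarFun_eq_zero h])
    rw [Finset.sum_congr rfl h3, ← integral_finsetSum s fun q _ => hint p q p (Or.inl rfl)]
    refine integral_congr_ae (Filter.Eventually.of_forall fun z => ?_)
    simp only [density]
    rw [← Finset.sum_mul, ← Finset.sum_mul, hs1, one_mul]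
  rw [Finset.sum_congr rfl fun p _ => h1 p, Finset.sum_neg_distrib, neg_eq_zero,
    Finset.sum_congr rfl fun p _ => h2 p, Finset.sum_comm]
  refine Finset.sum_eq_zero fun q _ => ?_
  -- With `q` fixed, the integrands cancel because `∑ ∂̄ρ_p = ∂̄1 = 0`.
  rw [← integral_finsetSum s fun p _ => hint p q q (Or.inr rfl)]
  refine (integral_congr_ae (Filter.Eventually.of_forall fun z => ?_)).trans (integral_zero _ _)
  simp only [density]
  rw [← Finset.sum_mul, ← Finset.mul_sum, ← Finset.sum_mul, sum_dbarFun_eq_zero hs1]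
  simp

/-- Two `(1,1)`-forms with continuous coefficients whose sum is exact have opposite integrals. -/
theorem integral_add_eq_zero
    {η θ : Π p : X, TangentSpace 𝓘(ℂ) p → TangentSpace 𝓘(ℂ) p → ℂ} {m k α : X → ℂ}
    (hη : ∀ (q : X) (v w : ℂ), η q v w = m q * (starRingEnd ℂ v * w - starRingEnd ℂ w * v))
    (hθ : ∀ (q : X) (v w : ℂ), θ q v w = k q * (starRingEnd ℂ v * w - starRingEnd ℂ w * v))
    (hm : ContForm m) (hα : SmoothForm α) (h : ∀ q, dbarForm α q = -(m q + k q)) :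
    integral η + integral θ = 0 := by
  obtain ⟨s, hs, hs1⟩ := exists_partFun_finset X
  -- The regularity of `k` follows from that of `m` and `∂̄α`; for the curvature this spares a
  -- separate continuity proof.
  have hk : ∀ q, k q = -(m q + dbarForm α q) := fun q => by rw [h]; ring
  have hi : ∀ {μ : X → ℂ} (_ : ContForm μ) (p : X), IntegrableOn
      (density (fun x => partFun X p x * μ x) p) (chartAt ℂ p).target := fun hμ p =>
    (hμ.mul (partFun_continuous p)).integrableOn (tsupport_partFun p) fun x hx =>
      subset_tsupport _ fun h => hx (by simp [h])
  rw [integral_eq_sum hs hη, integral_eq_sum hs hθ, ← mul_add, ← Finset.sum_add_distrib]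
  have h1 : ∀ p, ∫ z in (chartAt ℂ p).target, density (fun x => partFun X p x * k x) p z =
      -((∫ z in (chartAt ℂ p).target, density (fun x => partFun X p x * m x) p z) +
        ∫ z in (chartAt ℂ p).target, density (fun x => partFun X p x * dbarForm α x) p z) := by
    intro p
    rw [← integral_add (hi hm p) (hi (contForm_dbarForm hα) p), ← integral_neg]
    refine integral_congr_ae (Filter.Eventually.of_forall fun z => ?_)
    simp only [density, hk]
    ring
  simp only [h1, neg_add, ← add_assoc, add_neg_cancel, zero_add, Finset.sum_neg_distrib]
  rw [sum_integral_dbarForm_eq_zero hs1 hα]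
  simp

end Stokes

/-! ### Local frames of holomorphic bundles -/

section Frames

variable {X : Type*} [TopologicalSpace X] [ChartedSpace ℂ X]

theorem contDiffAt_chart_of_holomorphic {F : Type*} [NormedAddCommGroup F] [NormedSpace ℂ F]
    {f : X → F} {p : X} (hf : ContMDiffAt 𝓘(ℂ) 𝓘(ℂ, F) ω f p) :
    ContDiffAt ℂ ω (f ∘ (chartAt ℂ p).symm) (chartAt ℂ p p) := by
  have h2 := (contMDiffAt_iff.1 hf).2
  simp only [mfld_simps] at h2
  exact contDiffWithinAt_univ.1 h2

theorem contDiffAt_chart_of_smooth {F : Type*} [NormedAddCommGroup F] [NormedSpace ℝ F]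
    {f : X → F} {p : X} (hf : ContMDiffAt 𝓘(ℝ, ℂ) 𝓘(ℝ, F) ∞ f p) :
    ContDiffAt ℝ ∞ (f ∘ (chartAt ℂ p).symm) (chartAt ℂ p p) := by
  have h2 := (contMDiffAt_iff.1 hf).2
  simp only [mfld_simps] at h2
  exact contDiffWithinAt_univ.1 h2

theorem contMDiffAt_real_of_holomorphic {F : Type*} [NormedAddCommGroup F] [NormedSpace ℂ F]
    {f : X → F} {p : X} (hf : ContMDiffAt 𝓘(ℂ) 𝓘(ℂ, F) ω f p) :
    ContMDiffAt 𝓘(ℝ, ℂ) 𝓘(ℝ, F) ∞ f p := by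
  have h := contMDiffAt_iff.1 hf
  refine contMDiffAt_iff.2 ⟨h.1, ?_⟩
  have h2 := h.2
  simp only [mfld_simps] at h2 ⊢
  exact (h2.restrict_scalars ℝ).of_le le_top

theorem eventually_chart {P : X → Prop} {p : X} (h : ∀ᶠ q in 𝓝 p, P q) :
    ∀ᶠ z in 𝓝 (chartAt ℂ p p), P ((chartAt ℂ p).symm z) := by
  have hc := (chartAt ℂ p).continuousAt_symm (mem_chart_target ℂ p)
  rw [ContinuousAt, (chartAt ℂ p).left_inv (mem_chart_source ℂ p)] at hc
  exact hc.eventually h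

theorem mvfderiv_eq_deriv {f : X → ℂ} {p : X} (hf : HolFunAt f p) (v : ℂ) :
    mvfderiv 𝓘(ℂ) f p v = v * deriv (f ∘ (chartAt ℂ p).symm) (chartAt ℂ p p) := by
  have h : MDifferentiableAt 𝓘(ℂ) 𝓘(ℂ) f p := ContMDiffAt.mdifferentiableAt hf (by simp)
  have h1 : mvfderiv 𝓘(ℂ) f p v =
      fderiv ℂ (f ∘ (chartAt ℂ p).symm) (chartAt ℂ p p) v := by
    change mfderiv 𝓘(ℂ) 𝓘(ℂ) f p v = _
    rw [h.mfderiv]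
    simp only [writtenInExtChartAt, mfld_simps, fderivWithin_univ]
    rfl
  rw [h1, fderiv_eq_smul_deriv, smul_eq_mul]

variable {F : Type*} [NormedAddCommGroup F] [NormedSpace ℂ F]
  {V : X → Type*} [TopologicalSpace (TotalSpace F V)] [∀ p, AddCommGroup (V p)]
  [∀ p, Module ℂ (V p)] [∀ p, TopologicalSpace (V p)] [FiberBundle F V] [VectorBundle ℂ F V]

theorem symm_smul {p q : X} (hq : q ∈ (trivializationAt F V p).baseSet) (a : ℂ) (y : F) :
    (trivializationAt F V p).symm q (a • y) = a • (trivializationAt F V p).symm q y := by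
  rw [← (trivializationAt F V p).coe_symmₗ (R := ℂ) hq, map_smul]

theorem symm_coord {p q : X} (hq : q ∈ (trivializationAt F V p).baseSet) (u : Π q, V q) :
    (trivializationAt F V p).symm q (coord F u p q) = u q :=
  (trivializationAt F V p).symm_apply_apply_mk hq _

theorem holAt_iff_coord {u : Π q, V q} {p : X} :
    HolAt F u p ↔ ContMDiffAt 𝓘(ℂ) 𝓘(ℂ, F) ω (coord F u p) p := by
  rw [HolAt, contMDiffAt_totalSpace]
  exact ⟨fun h => h.2, fun h => ⟨contMDiffAt_id, h⟩⟩

section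

variable [IsManifold 𝓘(ℂ) ω X]

theorem coordVec_self (p : X) (w : ℂ) : coordVec p p w = w := by
  rw [coordVec_eq (mem_chart_source ℂ p), coordDeriv_self, mul_one]

theorem coordVec_eq_smul {p q : X} (hq : q ∈ (chartAt ℂ p).source) :
    coordVec p q 1 = coordDeriv p q • coordVec q q 1 :=
  (coordVec_eq hq 1).trans ((mul_comm (1 : ℂ) (coordDeriv p q)).trans
    (congrArg (fun w : ℂ => coordDeriv p q * w) (coordVec_self q 1).symm))

theorem tangent_eq_smul (p : X) (v : ℂ) :
    (show TangentSpace 𝓘(ℂ) p from v) = v • coordVec p p 1 :=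
  (mul_one v).symm.trans (congrArg (fun w : ℂ => v * w) (coordVec_self p 1).symm)

theorem dbar_coordVec (u : Π q, V q) (p : X) :
    dbar F u p (coordVec p p 1) = dbarCoeff F u p := by
  refine (congrArg (fun w : ℂ => starRingEnd ℂ w • dbarCoeff F u p) (coordVec_self p 1)).trans ?_
  rw [map_one, one_smul]

end

variable [IsManifold 𝓘(ℂ) ω X] [ContMDiffVectorBundle ω F V 𝓘(ℂ)]

theorem holAt_symm {p q : X} (hq : q ∈ (trivializationAt F V p).baseSet) (y : F) :
    HolAt F (fun r => (trivializationAt F V p).symm r y) q := by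
  refine ((trivializationAt F V p).contMDiffAt_section_iff hq).2 ?_
  refine (contMDiffAt_const (c := y)).congr_of_eventuallyEq ?_
  filter_upwards [(trivializationAt F V p).open_baseSet.mem_nhds hq] with r hr
  rw [(trivializationAt F V p).apply_mk_symm hr]

end Frames

/-! ### Frames and coframes of a line bundle. -/

section LineFrame

variable {X : Type*} [TopologicalSpace X] [ChartedSpace ℂ X]
  (L : X → Type*) [TopologicalSpace (TotalSpace ℂ L)] [∀ p, AddCommGroup (L p)]
  [∀ p, Module ℂ (L p)] [∀ p, TopologicalSpace (L p)] [FiberBundle ℂ L] [VectorBundle ℂ ℂ L]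

/-- The local holomorphic frame of `L` around `p`. -/
def frame (p q : X) : L q := (trivializationAt ℂ L p).symm q 1

/-- The dual of the local frame of `L` around `p`. -/
def coframe (p q : X) : Module.Dual ℂ (L q) := (trivializationAt ℂ L p).linearMapAt ℂ q

variable {L}

theorem coframe_apply {p q : X} (hq : q ∈ (trivializationAt ℂ L p).baseSet) (l : L q) :
    coframe L p q l = (trivializationAt ℂ L p ⟨q, l⟩).2 :=
  (trivializationAt ℂ L p).linearMapAt_apply (R := ℂ) l |>.trans (if_pos hq)

theorem coframe_frame {p q : X} (hq : q ∈ (trivializationAt ℂ L p).baseSet) :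
    coframe L p q (frame L p q) = 1 := by
  rw [coframe_apply hq, frame, (trivializationAt ℂ L p).apply_mk_symm hq]

theorem coframe_smul_frame {p q : X} (hq : q ∈ (trivializationAt ℂ L p).baseSet) (l : L q) :
    coframe L p q l • frame L p q = l := by
  rw [frame, ← symm_smul hq, smul_eq_mul, mul_one, coframe_apply hq]
  exact (trivializationAt ℂ L p).symm_apply_apply_mk hq l

theorem dual_eq_smul_coframe {p q : X} (hq : q ∈ (trivializationAt ℂ L p).baseSet)
    (ξ : Module.Dual ℂ (L q)) : ξ = ξ (frame L p q) • coframe L p q := by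
  ext l
  conv_lhs => rw [← coframe_smul_frame hq l]
  simp [mul_comm]

theorem frame_ne_zero {p q : X} (hq : q ∈ (trivializationAt ℂ L p).baseSet) :
    frame L p q ≠ 0 := fun h => by
  have := coframe_frame hq
  rw [h, map_zero] at this
  exact zero_ne_one this

/-- The fibre is a line, so `f` is a scalar and equals its own trace. -/
theorem trace_eq_coframe {p q : X} (hq : q ∈ (trivializationAt ℂ L p).baseSet)
    (f : L q →ₗ[ℂ] L q) : LinearMap.trace ℂ (L q) f = coframe L p q (f (frame L p q)) := by
  have h1 : Module.finrank ℂ (L q) = 1 := finrank_eq_one (frame L p q) (frame_ne_zero hq)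
    fun l => ⟨_, coframe_smul_frame hq l⟩
  have : Module.Finite ℂ (L q) := Module.finite_of_finrank_eq_succ h1
  have h : f = coframe L p q (f (frame L p q)) • LinearMap.id := by
    ext l
    conv_lhs => rw [← coframe_smul_frame hq l, map_smul, ← coframe_smul_frame hq (f _)]
    rw [smul_comm, coframe_smul_frame hq l]
    rfl
  conv_lhs => rw [h, map_smul, LinearMap.trace_id, h1]
  simp

variable [IsManifold 𝓘(ℂ) ω X] [ContMDiffVectorBundle ω ℂ L 𝓘(ℂ)]

theorem holAt_frame {p q : X} (hq : q ∈ (trivializationAt ℂ L p).baseSet) :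
    HolAt ℂ (frame L p) q := holAt_symm hq 1

theorem holFunAt_coframe {p q : X} (hq : q ∈ (trivializationAt ℂ L p).baseSet) {s : Π q, L q}
    (hs : HolAt ℂ s q) : HolFunAt (fun r => coframe L p r (s r)) q := by
  refine ContMDiffAt.congr_of_eventuallyEq
    (((trivializationAt ℂ L p).contMDiffAt_section_iff hq).1 hs) ?_
  filter_upwards [(trivializationAt ℂ L p).open_baseSet.mem_nhds hq] with r hr
  exact coframe_apply hr _

theorem holDualAt_coframe {p q : X} (hq : q ∈ (trivializationAt ℂ L p).baseSet) :
    HolDualAt (coframe L p) q := fun _ hs => holFunAt_coframe hq hs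

/-- The coordinate vector field of a chart is holomorphic. -/
theorem holAt_coordVec (p : X) : HolAt ℂ (fun q => coordVec p q 1) p := by
  -- The tangent bundle usually loses one derivative; here `ω + 1` is `ω`.
  have : IsManifold 𝓘(ℂ) (ω + 1) X := inferInstanceAs (IsManifold 𝓘(ℂ) ω X)
  exact holAt_symm (V := (TangentSpace 𝓘(ℂ) : X → Type _))
    (FiberBundle.mem_baseSet_trivializationAt' p) 1

end LineFrame

/-! ### The extension class -/

section Extension

variable {X : Type*} [TopologicalSpace X] [ChartedSpace ℂ X] [IsManifold 𝓘(ℂ) ω X]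
  {L : X → Type*} [TopologicalSpace (TotalSpace ℂ L)] [∀ p, AddCommGroup (L p)]
  [∀ p, Module ℂ (L p)] [∀ p, TopologicalSpace (L p)] [FiberBundle ℂ L] [VectorBundle ℂ ℂ L]
  [ContMDiffVectorBundle ω ℂ L 𝓘(ℂ)]
  {E : X → Type*} [TopologicalSpace (TotalSpace (Fin 2 → ℂ) E)] [∀ p, AddCommGroup (E p)]
  [∀ p, Module ℂ (E p)] [∀ p, TopologicalSpace (E p)] [FiberBundle (Fin 2 → ℂ) E]
  [VectorBundle ℂ (Fin 2 → ℂ) E] [ContMDiffVectorBundle ω (Fin 2 → ℂ) E 𝓘(ℂ)]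

/-- The regularity of `ι` is known only on holomorphic sections. Writing `r` as a coefficient times
the holomorphic frame lets `ι` act on the frame alone, so that `ι` preserves smoothness and commutes
with `∂̄`. -/
theorem Embedding.coord_eventuallyEq (ι : Embedding L E) (r : Π q, L q) (p : X) :
    coord (Fin 2 → ℂ) (fun q => ι.toFun q (r q)) p =ᶠ[𝓝 p] fun q =>
      coord ℂ r p q • coord (Fin 2 → ℂ) (fun q => ι.toFun q (frame L p q)) p q := by
  filter_upwards [(trivializationAt ℂ L p).open_baseSet.mem_nhds
    (FiberBundle.mem_baseSet_trivializationAt' p),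
    (trivializationAt (Fin 2 → ℂ) E p).open_baseSet.mem_nhds
    (FiberBundle.mem_baseSet_trivializationAt' p)] with q hq hq'
  have h : r q = coord ℂ r p q • frame L p q := by
    rw [coord, ← coframe_apply hq, coframe_smul_frame hq]
  simp only [coord] at h ⊢
  conv_lhs => rw [h, map_smul]
  exact ((trivializationAt (Fin 2 → ℂ) E p).linear ℂ hq').map_smul _ _

theorem Embedding.smoothAt_comp (ι : Embedding L E) {r : Π q, L q} {p : X}
    (hr : SmoothAt ℂ r p) : SmoothAt (Fin 2 → ℂ) (fun q => ι.toFun q (r q)) p := by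
  have h1 := contMDiffAt_real_of_holomorphic (holAt_iff_coord.1 (ι.holomorphic p _
    (holAt_frame (L := L) (FiberBundle.mem_baseSet_trivializationAt' p))))
  refine ContMDiffAt.congr_of_eventuallyEq ?_ (ι.coord_eventuallyEq r p)
  have h2 : ContDiff ℝ ∞ fun x : ℂ × (Fin 2 → ℂ) => x.1 • x.2 := contDiff_fst.smul contDiff_snd
  exact h2.contMDiff.contMDiffAt.comp p (ContMDiffAt.prodMk_space hr h1)

theorem Embedding.dbarCoeff_comp (ι : Embedding L E) {r : Π q, L q} {p : X}
    (hr : SmoothAt ℂ r p) : dbarCoeff (Fin 2 → ℂ) (fun q => ι.toFun q (r q)) p =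
      ι.toFun p (dbarCoeff ℂ r p) := by
  have hL := FiberBundle.mem_baseSet_trivializationAt' (F := ℂ) (E := L) p
  have hE := FiberBundle.mem_baseSet_trivializationAt' (F := Fin 2 → ℂ) (E := E) p
  have h1 := (contDiffAt_chart_of_holomorphic (holAt_iff_coord.1 (ι.holomorphic p _
    (holAt_frame (L := L) hL)))).differentiableAt (by simp)
  have h2 := dzbar_smul hr.differentiableAt (h1.restrictScalars ℝ)
  rw [dzbar_eq_zero h1, smul_zero, add_zero] at h2
  have h3 : (coord (Fin 2 → ℂ) (fun q => ι.toFun q (frame L p q)) p ∘ (chartAt ℂ p).symm)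
      (chartAt ℂ p p) = coord (Fin 2 → ℂ) (fun q => ι.toFun q (frame L p q)) p p := by
    rw [Function.comp_apply, (chartAt ℂ p).left_inv (mem_chart_source ℂ p)]
  rw [dbarCoeff, dzbar_congr (chart_eventually (ι.coord_eventuallyEq r p))]
  refine (congrArg _ h2).trans ?_
  rw [symm_smul hE, h3, symm_coord hE, ← map_smul, frame, ← symm_smul hL, smul_eq_mul, mul_one]
  rfl

theorem Embedding.dbar_comp (ι : Embedding L E) {r : Π q, L q} {p : X}
    (hr : SmoothAt ℂ r p) (v : TangentSpace 𝓘(ℂ) p) :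
    dbar (Fin 2 → ℂ) (fun q => ι.toFun q (r q)) p v = ι.toFun p (dbar ℂ r p v) := by
  refine (congrArg _ (ι.dbarCoeff_comp hr)).trans (map_smul _ _ _).symm

/-- Every Dolbeault representative of the extension class is `∂̄` of a smooth splitting. -/
theorem Embedding.IsExtensionClass.exists_splitting {ι : Embedding L E} {D : DetTrivialization E}
    {x : H1Sq L} (hx : ι.IsExtensionClass D x) {β : Form01Sq L}
    (hβ : Submodule.Quotient.mk β = x) :
    ∃ σ : Π p, Module.Dual ℂ (L p) →ₗ[ℂ] E p, SmoothHom (Fin 2 → ℂ) σ ∧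
      (∀ p, ι.proj D p ∘ₗ σ p = LinearMap.id) ∧
      IsDbarHom (Fin 2 → ℂ) σ
        (fun p => (LinearMap.compRight ℂ (ι.toFun p)).comp (β.1 p)) := by
  obtain ⟨σ, β', hσ, hs, hd, rfl⟩ := hx
  obtain ⟨u, hu, hud⟩ := (Submodule.Quotient.eq _).1 hβ
  -- The two representatives differ by `∂̄u`. Adding `ι u` absorbs this, and does not disturb the
  -- splitting since the projection kills the image of `ι`.
  refine ⟨fun p => σ p + ι.toFun p ∘ₗ u p, fun p ξ hξ => ?_, fun p => ?_, fun p ξ hξ v => ?_⟩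
  · exact (hσ p ξ hξ).add (ι.smoothAt_comp (hu p ξ hξ))
  · ext1 ξ
    have h := LinearMap.congr_fun (hs p) ξ
    simp only [LinearMap.comp_apply, LinearMap.add_apply, map_add, ι.proj_apply_self,
      add_zero] at h ⊢
    exact h
  · have h1 := LinearMap.congr_fun
      (dbar_add (hσ p ξ hξ) (ι.smoothAt_comp (hu p ξ hξ))) v
    refine Eq.trans ?_ h1.symm
    rw [LinearMap.add_apply, ι.dbar_comp (hu p ξ hξ), ← hd p ξ hξ, ← hud p ξ hξ]
    have h2 : (β - β' : Form01Sq L).1 p v (ξ p) = β.1 p v (ξ p) - β'.1 p v (ξ p) := rfl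
    rw [h2, map_sub]
    change ι.toFun p (β.1 p v (ξ p)) = ι.toFun p (β'.1 p v (ξ p)) + _
    abel

/-- Expanding `u` in a holomorphic frame of `E` separates its coefficients, later merely smooth,
from pairings of holomorphic sections, the only ones that `D.holomorphic` controls. -/
theorem DetTrivialization.pairing_eventuallyEq (D : DetTrivialization E) (w u : Π q, E q)
    (p : X) : (fun q => D.toFun q (w q) (u q)) =ᶠ[𝓝 p] fun q => ∑ i,
      coord (Fin 2 → ℂ) u p q i *
        D.toFun q (w q) ((trivializationAt (Fin 2 → ℂ) E p).symm q (Pi.single i 1)) := by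
  filter_upwards [(trivializationAt (Fin 2 → ℂ) E p).open_baseSet.mem_nhds
    (FiberBundle.mem_baseSet_trivializationAt' p)] with q hq
  conv_lhs => rw [← symm_coord (F := Fin 2 → ℂ) hq u, pi_eq_sum_univ' (coord _ u p q)]
  rw [← (trivializationAt (Fin 2 → ℂ) E p).coe_symmₗ (R := ℂ) hq]
  simp only [map_sum, map_smul, smul_eq_mul]

theorem DetTrivialization.holomorphic_pairing (D : DetTrivialization E) {w : Π q, E q} {p : X}
    (hw : HolAt (Fin 2 → ℂ) w p) (i : Fin 2) : HolFunAt (fun q => D.toFun q (w q)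
      ((trivializationAt (Fin 2 → ℂ) E p).symm q (Pi.single i 1))) p :=
  D.holomorphic p _ _ hw (holAt_symm (FiberBundle.mem_baseSet_trivializationAt' p) _)

theorem SmoothAt.contDiffAt_coord {u : Π q, E q} {p : X} (hu : SmoothAt (Fin 2 → ℂ) u p)
    (i : Fin 2) :
    ContDiffAt ℝ ∞ (fun z => coord (Fin 2 → ℂ) u p ((chartAt ℂ p).symm z) i)
      (chartAt ℂ p p) :=
  contDiffAt_pi.1 (contDiffAt_chart_of_smooth hu) i

theorem DetTrivialization.contDiffAt_pairing (D : DetTrivialization E) {w u : Π q, E q} {p : X}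
    (hw : HolAt (Fin 2 → ℂ) w p) (hu : SmoothAt (Fin 2 → ℂ) u p) :
    ContDiffAt ℝ ∞ ((fun q => D.toFun q (w q) (u q)) ∘ (chartAt ℂ p).symm) (chartAt ℂ p p) := by
  refine ContDiffAt.congr_of_eventuallyEq ?_ (chart_eventually (D.pairing_eventuallyEq w u p))
  exact ContDiffAt.sum fun i _ => (hu.contDiffAt_coord i).mul
    (contDiffAt_chart_of_smooth (D.holomorphic_pairing hw i).contMDiffAt_real)

/-- As `D`, `w` and the frame of `E` are holomorphic, the product rule leaves only the
`∂̄`-derivatives of the coefficients of `u`. -/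
theorem DetTrivialization.dzbar_pairing (D : DetTrivialization E) {w u : Π q, E q} {p : X}
    (hw : HolAt (Fin 2 → ℂ) w p) (hu : SmoothAt (Fin 2 → ℂ) u p) :
    dzbar ((fun q => D.toFun q (w q) (u q)) ∘ (chartAt ℂ p).symm) (chartAt ℂ p p) =
      D.toFun p (w p) (dbarCoeff (Fin 2 → ℂ) u p) := by
  have hE := FiberBundle.mem_baseSet_trivializationAt' (F := Fin 2 → ℂ) (E := E) p
  have h1 := fun i => (contDiffAt_chart_of_holomorphic
    (D.holomorphic_pairing hw i)).differentiableAt (by simp)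
  have h2 := fun i => (hu.contDiffAt_coord i).differentiableAt (by simp)
  rw [dzbar_congr (chart_eventually (D.pairing_eventuallyEq w u p))]
  refine (dzbar_sum Finset.univ fun i _ => (h2 i).mul ((h1 i).restrictScalars ℝ)).trans ?_
  have h3 : dbarCoeff (Fin 2 → ℂ) u p = ∑ i,
      dzbar (fun z => coord (Fin 2 → ℂ) u p ((chartAt ℂ p).symm z) i) (chartAt ℂ p p) •
        (trivializationAt (Fin 2 → ℂ) E p).symm p (Pi.single i 1) := by
    rw [dbarCoeff, ← (trivializationAt (Fin 2 → ℂ) E p).coe_symmₗ (R := ℂ) hE]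
    simp only [← map_smul, ← map_sum]
    congr 1
    ext j
    have h4 : ∀ v, fderiv ℝ (coord (Fin 2 → ℂ) u p ∘ (chartAt ℂ p).symm) (chartAt ℂ p p) v j =
        fderiv ℝ (fun z => coord (Fin 2 → ℂ) u p ((chartAt ℂ p).symm z) j)
          (chartAt ℂ p p) v := fun v => by
      exact (DFunLike.congr_fun
        ((hasFDerivAt_pi'.1 hu.differentiableAt.hasFDerivAt) j).fderiv v).symm
    simp [dzbar, h4, Finset.sum_apply, Pi.single_apply]
  rw [h3, map_sum]
  refine Finset.sum_congr rfl fun i _ => ?_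
  rw [map_smul, smul_eq_mul]
  refine (dzbar_mul (h2 i) ((h1 i).restrictScalars ℝ)).trans ?_
  rw [dzbar_eq_zero (h1 i), mul_zero, add_zero, Function.comp_apply,
    (chartAt ℂ p).left_inv (mem_chart_source ℂ p)]

end Extension

/-! ### The connection form -/

section ConnectionForm

variable {X : Type*} [TopologicalSpace X] [ChartedSpace ℂ X] [IsManifold 𝓘(ℂ) ω X]
  {L : X → Type*} [TopologicalSpace (TotalSpace ℂ L)] [∀ p, AddCommGroup (L p)]
  [∀ p, Module ℂ (L p)] [∀ p, TopologicalSpace (L p)] [FiberBundle ℂ L] [VectorBundle ℂ ℂ L]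
  [ContMDiffVectorBundle ω ℂ L 𝓘(ℂ)]
  {E : X → Type*} [TopologicalSpace (TotalSpace (Fin 2 → ℂ) E)] [∀ p, AddCommGroup (E p)]
  [∀ p, Module ℂ (E p)] [∀ p, TopologicalSpace (E p)] [FiberBundle (Fin 2 → ℂ) E]
  [VectorBundle ℂ (Fin 2 → ℂ) E] [ContMDiffVectorBundle ω (Fin 2 → ℂ) E 𝓘(ℂ)]

/-- `log |e|²` in the chart around `p`, where `e` is the local frame of `L` around `p`. -/
def HermitianMetric.logNorm (h : HermitianMetric L) (p : X) (z : ℂ) : ℂ :=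
  (Real.log (h.normSq ((chartAt ℂ p).symm z) (frame L p ((chartAt ℂ p).symm z))) : ℂ)

theorem HermitianMetric.contMDiffAt_log (h : HermitianMetric L) {p q : X}
    (hq : q ∈ (trivializationAt ℂ L p).baseSet) : ContMDiffAt 𝓘(ℝ, ℂ) 𝓘(ℝ, ℂ) ∞
      (fun r => (Real.log (h.normSq r (frame L p r)) : ℂ)) q := by
  have h1 := h.smooth q _ (holAt_frame hq)
  have h2 : ContDiffAt ℝ ∞ (fun t : ℝ => (Real.log t : ℂ)) (h.normSq q (frame L p q)) :=
    Complex.ofRealCLM.contDiff.contDiffAt.comp _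
      (Real.contDiffAt_log.2 (h.normSq_pos q _ (frame_ne_zero hq)).ne')
  exact h2.contMDiffAt.comp q h1

theorem HermitianMetric.contDiffAt_logNorm (h : HermitianMetric L) (p : X) :
    ContDiffAt ℝ ∞ (h.logNorm p) (chartAt ℂ p p) :=
  contDiffAt_chart_of_smooth
    (h.contMDiffAt_log (FiberBundle.mem_baseSet_trivializationAt' p))

theorem HermitianMetric.differentiableAt_logNorm (h : HermitianMetric L) {p q : X}
    (hq : q ∈ (trivializationAt ℂ L p).baseSet) (hp : q ∈ (chartAt ℂ p).source) :
    DifferentiableAt ℝ (h.logNorm p) (chartAt ℂ p q) := by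
  have : IsManifold 𝓘(ℝ, ℂ) ∞ X := isManifold_real
  have h1 := (contMDiffOn_chart_symm (I := 𝓘(ℝ, ℂ)) (n := ∞) (x := p)).contMDiffAt
    ((chartAt ℂ p).open_target.mem_nhds ((chartAt ℂ p).map_source hp))
  have h2 := h.contMDiffAt_log hq
  rw [← (chartAt ℂ p).left_inv hp] at h2
  exact (h2.comp _ h1).contDiffAt.differentiableAt (by simp)

/-- The behaviour of `∂ log |e|²` under a change of the chart and the frame. -/
theorem HermitianMetric.dz_logNorm (h : HermitianMetric L) {p q : X}
    (hq : q ∈ (trivializationAt ℂ L p).baseSet) (hp : q ∈ (chartAt ℂ p).source) :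
    dz (h.logNorm q) (chartAt ℂ q q) =
      deriv ((fun r => coframe L p r (frame L q r)) ∘ (chartAt ℂ q).symm) (chartAt ℂ q q) /
        coframe L p q (frame L q q) +
      deriv (chartAt ℂ p ∘ (chartAt ℂ q).symm) (chartAt ℂ q q) *
        dz (h.logNorm p) (chartAt ℂ p q) := by
  have hqq := FiberBundle.mem_baseSet_trivializationAt' (F := ℂ) (E := L) q
  set g : X → ℂ := fun r => coframe L p r (frame L q r) with hg
  have hg0 : ∀ r, r ∈ (trivializationAt ℂ L p).baseSet → r ∈ (trivializationAt ℂ L q).baseSet →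
      g r ≠ 0 := fun r hr hr' h0 => frame_ne_zero hr' (by
    rw [← coframe_smul_frame hr (frame L q r)]
    exact (congrArg (· • _) h0).trans (zero_smul _ _))
  have hgd := (contDiffAt_chart_of_holomorphic
    (holFunAt_coframe hq (holAt_frame (L := L) hqq))).differentiableAt (by simp)
  have hcc := (chartAt ℂ q).left_inv (mem_chart_source ℂ q)
  -- From `e_q = g e_p`: `log |e_q|² = log |g|² + log |e_p|²`.
  have hev : h.logNorm q =ᶠ[𝓝 (chartAt ℂ q q)] fun z =>
      (Real.log (‖(g ∘ (chartAt ℂ q).symm) z‖ ^ 2) : ℂ) +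
        (h.logNorm p ∘ (chartAt ℂ p ∘ (chartAt ℂ q).symm)) z := by
    filter_upwards [eventually_chart ((trivializationAt ℂ L p).open_baseSet.mem_nhds hq),
      eventually_chart ((trivializationAt ℂ L q).open_baseSet.mem_nhds hqq),
      eventually_chart ((chartAt ℂ p).open_source.mem_nhds hp)] with z hz1 hz2 hz3
    have h1 : frame L q ((chartAt ℂ q).symm z) =
        g ((chartAt ℂ q).symm z) • frame L p ((chartAt ℂ q).symm z) :=
      (coframe_smul_frame hz1 _).symm
    have h2 := hg0 _ hz1 hz2
    have h3 := (h.normSq_pos _ _ (frame_ne_zero hz1)).ne'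
    have h5 : h.logNorm p (chartAt ℂ p ((chartAt ℂ q).symm z)) = _ :=
      congrArg (fun r => (Real.log (h.normSq r (frame L p r)) : ℂ)) ((chartAt ℂ p).left_inv hz3)
    simp only [Function.comp_apply]
    rw [h5, HermitianMetric.logNorm, h1, h.normSq_smul, Real.log_mul (by simpa using h2) h3, Complex.ofReal_add]
  have hφ : (chartAt ℂ p ∘ (chartAt ℂ q).symm) (chartAt ℂ q q) = chartAt ℂ p q := by simp [hcc]
  have h1 := h.differentiableAt_logNorm hq hp
  rw [← hφ] at h1
  have h2 := transition_differentiableAt (mem_chart_source ℂ q) hp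
  have hg1 : (g ∘ (chartAt ℂ q).symm) (chartAt ℂ q q) ≠ 0 := by
    rw [Function.comp_apply, hcc]
    exact hg0 q hq hqq
  have h3 : DifferentiableAt ℝ (fun z => (Real.log (‖(g ∘ (chartAt ℂ q).symm) z‖ ^ 2) : ℂ))
      (chartAt ℂ q q) := by
    have h4 : DifferentiableAt ℝ (fun z => ‖(g ∘ (chartAt ℂ q).symm) z‖ ^ 2)
      (chartAt ℂ q q) := (hgd.restrictScalars ℝ).norm_sq ℝ
    exact Complex.ofRealCLM.differentiableAt.comp _ (h4.log (by simpa using hg1))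
  rw [dz_congr hev, dz_add h3 (h1.comp _ (h2.restrictScalars ℝ)), dz_log_norm_sq hgd hg1,
    dz_comp h1 h2, hφ, smul_eq_mul, Function.comp_apply, hcc]

variable {D : DetTrivialization E} {lam : ℂ} (N : LambdaConnection lam D) (ι : Embedding L E)
  (σ : Π p, Module.Dual ℂ (L p) →ₗ[ℂ] E p)

/-- The component along `e` of `∇_V (ι e)`, where `e` is the local frame of `L` around `p` and `V`
is the coordinate vector field `∂/∂z`, with respect to the splitting `σ`. -/
def LambdaConnection.connCoeff (p q : X) : ℂ :=
  D.toFun q (N.toFun (fun r => ι.toFun r (frame L p r)) q (coordVec p q 1))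
    (σ q (coframe L p q))

/-- The difference between the connection form on `L` induced by `∇` and `σ` and `λ` times the
Chern connection form of a Hermitian metric: a global `(1,0)`-form. -/
def LambdaConnection.connForm (h : HermitianMetric L) (p : X) : ℂ :=
  N.connCoeff ι σ p p - lam * dz (h.logNorm p) (chartAt ℂ p p)

variable {N ι σ}

theorem det_embedding_splitting (hs : ∀ p, ι.proj D p ∘ₗ σ p = LinearMap.id) {q : X} (l : L q)
    (ξ : Module.Dual ℂ (L q)) : D.toFun q (ι.toFun q l) (σ q ξ) = ξ l :=
  LinearMap.congr_fun (LinearMap.congr_fun (hs q) ξ) l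

/-- With `e_q = g e_p` and `e_q* = g⁻¹ e_p*`, the Leibniz rule produces `λ dg/g` and `g` cancels
from the remaining term. The same inhomogeneous term occurs in `λ` times
`HermitianMetric.dz_logNorm`. -/
theorem LambdaConnection.connCoeff_eq (hs : ∀ p, ι.proj D p ∘ₗ σ p = LinearMap.id) {p q : X}
    (hq : q ∈ (trivializationAt ℂ L p).baseSet) (hp : q ∈ (chartAt ℂ p).source) :
    N.connCoeff ι σ q q * coordDeriv p q =
      lam * (deriv ((fun r => coframe L p r (frame L q r)) ∘ (chartAt ℂ q).symm)
        (chartAt ℂ q q) / coframe L p q (frame L q q)) * coordDeriv p q +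
      N.connCoeff ι σ p q := by
  have hqq := FiberBundle.mem_baseSet_trivializationAt' (F := ℂ) (E := L) q
  set g : X → ℂ := fun r => coframe L p r (frame L q r) with hg
  have hg0 : g q ≠ 0 := fun h0 => frame_ne_zero hqq (by
    rw [← coframe_smul_frame hq (frame L q q)]
    exact (congrArg (· • _) h0).trans (zero_smul _ _))
  have hgh : HolFunAt g q := holFunAt_coframe hq (holAt_frame (L := L) hqq)
  have hιp := ι.holomorphic q _ (holAt_frame (L := L) hq)
  have hιq := ι.holomorphic q _ (holAt_frame (L := L) hqq)
  have hev : ∀ᶠ r in 𝓝 q, ι.toFun r (frame L q r) = g r • ι.toFun r (frame L p r) := by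
    filter_upwards [(trivializationAt ℂ L p).open_baseSet.mem_nhds hq] with r hr
    rw [← map_smul]
    exact congrArg _ (coframe_smul_frame hr _).symm
  have h1 := N.congr q _ _ hιq (hgh.smul_section hιp) hev
  have h2 : N.toFun (fun r => ι.toFun r (frame L q r)) q (coordVec q q 1) =
      (lam * deriv (g ∘ (chartAt ℂ q).symm) (chartAt ℂ q q)) • ι.toFun q (frame L p q) +
        g q • N.toFun (fun r => ι.toFun r (frame L p r)) q (coordVec q q 1) := by
    have h4 : mvfderiv 𝓘(ℂ) g q (coordVec q q 1) =
        deriv (g ∘ (chartAt ℂ q).symm) (chartAt ℂ q q) :=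
      (congrArg _ (coordVec_self q 1)).trans ((mvfderiv_eq_deriv hgh 1).trans (one_mul _))
    rw [h1, ← h4]
    exact N.leibniz q g _ hgh hιp _
  have h3 : coframe L q q = (g q)⁻¹ • coframe L p q := by
    rw [dual_eq_smul_coframe hqq (coframe L p q), smul_smul]
    rw [show (coframe L p q) (frame L q q) = g q from rfl, inv_mul_cancel₀ hg0, one_smul]
  simp only [LambdaConnection.connCoeff]
  rw [coordVec_eq_smul hp, map_smul, h2, h3]
  simp only [map_add, map_smul, LinearMap.add_apply, LinearMap.smul_apply, smul_eq_mul,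
    det_embedding_splitting hs, coframe_frame hq]
  have h6 : coframe L p q (frame L q q) = g q := rfl
  rw [h6]
  field_simp

/-- `connForm` uses at every point the chart and frame of that point. Since the two inhomogeneous
terms cancel, near `p` it may be computed in the one chart and frame around `p`, where it can be
differentiated. -/
theorem LambdaConnection.coeff_connForm (hs : ∀ p, ι.proj D p ∘ₗ σ p = LinearMap.id)
    (h : HermitianMetric L) (p : X) :
    coeff (N.connForm ι σ h) p =ᶠ[𝓝 (chartAt ℂ p p)] fun z =>
      (N.connCoeff ι σ p ∘ (chartAt ℂ p).symm) z - lam * dz (h.logNorm p) z := by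
  have hp := FiberBundle.mem_baseSet_trivializationAt' (F := ℂ) (E := L) p
  filter_upwards [eventually_chart ((trivializationAt ℂ L p).open_baseSet.mem_nhds hp),
    (chartAt ℂ p).open_target.mem_nhds (mem_chart_target ℂ p)] with z hz hz'
  have hzs := (chartAt ℂ p).map_target hz'
  rw [coeff, LambdaConnection.connForm, sub_mul, N.connCoeff_eq hs hz hzs, h.dz_logNorm hz hzs,
    (chartAt ℂ p).right_inv hz']
  have h1 := deriv_transition_mul_coordDeriv hzs
  rw [Function.comp_apply]
  linear_combination (-lam * dz (h.logNorm p) z) * h1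

theorem LambdaConnection.holAt_nabla_frame (N : LambdaConnection lam D) (ι : Embedding L E)
    (p : X) : HolAt (Fin 2 → ℂ)
      (fun q => N.toFun (fun r => ι.toFun r (frame L p r)) q (coordVec p q 1)) p :=
  N.holomorphic p _ _ (ι.holomorphic p _
    (holAt_frame (L := L) (FiberBundle.mem_baseSet_trivializationAt' p))) (holAt_coordVec p)

theorem LambdaConnection.smoothForm_connForm (hσ : SmoothHom (Fin 2 → ℂ) σ)
    (hs : ∀ p, ι.proj D p ∘ₗ σ p = LinearMap.id) (h : HermitianMetric L) :
    SmoothForm (N.connForm ι σ h) := by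
  intro p
  have hp := FiberBundle.mem_baseSet_trivializationAt' (F := ℂ) (E := L) p
  refine ContDiffAt.congr_of_eventuallyEq ?_ (N.coeff_connForm hs h p)
  exact (D.contDiffAt_pairing (N.holAt_nabla_frame ι p) (hσ p _ (holDualAt_coframe hp))).sub
    (contDiffAt_const.mul (contDiffAt_dz (h.contDiffAt_logNorm p)))

/-- The coefficient of the `(1,1)`-form `β ∧ c`. -/
def wedgeCoeff (β : Form01Sq L) (c : H0KLinvSq L) (p : X) : ℂ :=
  LinearMap.trace ℂ (L p) (β.1 p (coordVec p p 1) ∘ₗ c.toFun p (coordVec p p 1))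

theorem trace_wedge (β : Form01Sq L) (c : H0KLinvSq L) {p q : X}
    (hq : q ∈ (trivializationAt ℂ L p).baseSet) (v w : TangentSpace 𝓘(ℂ) q) :
    LinearMap.trace ℂ (L q) (β.1 q v ∘ₗ c.toFun q w) =
      coframe L p q (β.1 q v (coframe L p q)) *
        c.toFun q w (frame L p q) (frame L p q) := by
  rw [trace_eq_coframe hq, LinearMap.comp_apply,
    dual_eq_smul_coframe hq (c.toFun q w (frame L p q)), map_smul, map_smul, smul_eq_mul,
    LinearMap.smul_apply, coframe_frame hq, smul_eq_mul, mul_one, mul_comm]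

/-- The tangent space is a complex line, on which `β` is conjugate-linear and `c` linear, so one
coefficient determines the form. -/
theorem trace_wedge_eq (β : Form01Sq L) (c : H0KLinvSq L) (p : X) (v w : ℂ) :
    LinearMap.trace ℂ (L p) (β.1 p v ∘ₗ c.toFun p w) =
      wedgeCoeff β c p * (starRingEnd ℂ v * w) := by
  have h1 : β.1 p v = starRingEnd ℂ v • β.1 p (coordVec p p 1) :=
    (congrArg (β.1 p) (tangent_eq_smul p v)).trans (map_smulₛₗ _ _ _)
  have h2 : c.toFun p w = w • c.toFun p (coordVec p p 1) :=
    (congrArg (c.toFun p) (tangent_eq_smul p w)).trans (map_smul _ _ _)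
  rw [h1, h2, LinearMap.smul_comp, LinearMap.comp_smul, map_smul, map_smul, wedgeCoeff,
    smul_eq_mul, smul_eq_mul]
  ring

theorem wedge_eq (β : Form01Sq L) (c : H0KLinvSq L) (p : X) (v w : ℂ) :
    wedge β c p v w = wedgeCoeff β c p * (starRingEnd ℂ v * w - starRingEnd ℂ w * v) := by
  refine (congrArg₂ (· - ·) (trace_wedge_eq β c p v w) (trace_wedge_eq β c p w v)).trans ?_
  ring

/-- Near the centre of a chart, frame and coframe factor the density into a coefficient of `β`,
which is smooth at the centre, and a holomorphic coefficient of `c`. -/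
theorem contForm_wedgeCoeff (β : Form01Sq L) (c : H0KLinvSq L) : ContForm (wedgeCoeff β c) := by
  refine contForm_of_center fun p => ?_
  have hp := FiberBundle.mem_baseSet_trivializationAt' (F := ℂ) (E := L) p
  have h1 : SmoothAt ℂ (fun q => β.1 q (coordVec p q 1) (coframe L p q)) p :=
    β.2 p _ _ (holAt_coordVec p) (holDualAt_coframe hp)
  have h2 := c.holomorphic p _ _ _ (holAt_coordVec p) (holAt_frame (L := L) hp)
    (holAt_frame (L := L) hp)
  have h3 := (contDiffAt_chart_of_smooth h1).continuousAt.mul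
    (contDiffAt_chart_of_holomorphic h2).continuousAt
  refine h3.congr ?_
  filter_upwards [eventually_chart ((trivializationAt ℂ L p).open_baseSet.mem_nhds hp),
    (chartAt ℂ p).open_target.mem_nhds (mem_chart_target ℂ p)] with z hz hz'
  have hzs := (chartAt ℂ p).map_target hz'
  have h4 := trace_wedge β c hz (coordVec p _ 1) (coordVec p _ 1)
  rw [coframe_apply hz] at h4
  refine h4.symm.trans ?_
  rw [coordVec_eq hzs, one_mul, trace_wedge_eq, density]

/-- Since `∇ ι e` is holomorphic, `∂̄` falls on `σ e*` alone and gives `det(∇ ι e, ι β e*)`. Here `β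
e*` is a multiple of `e`; swapping the arguments of `det` yields minus that multiple times
`c(e)(e)`, that is, minus the trace of `β ∘ c`. -/
theorem LambdaConnection.dbarForm_connForm (hσ : SmoothHom (Fin 2 → ℂ) σ)
    (hs : ∀ p, ι.proj D p ∘ₗ σ p = LinearMap.id) {β : Form01Sq L}
    (hβ : IsDbarHom (Fin 2 → ℂ) σ
      (fun p => (LinearMap.compRight ℂ (ι.toFun p)).comp (β.1 p)))
    (h : HermitianMetric L) (p : X) :
    dbarForm (N.connForm ι σ h) p =
      -(wedgeCoeff β (N.c ι) p + lam * dzbar (dz (h.logNorm p)) (chartAt ℂ p p)) := by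
  have hp := FiberBundle.mem_baseSet_trivializationAt' (F := ℂ) (E := L) p
  have hw := N.holAt_nabla_frame ι p
  have hu := hσ p _ (holDualAt_coframe (L := L) hp)
  have hd := (contDiffAt_dz (h.contDiffAt_logNorm p)).differentiableAt (by simp)
  have h1 := (D.contDiffAt_pairing hw hu).differentiableAt (by simp)
  rw [dbarForm, dzbar_congr (N.coeff_connForm hs h p)]
  refine (dzbar_sub h1 (hd.const_mul lam)).trans ?_
  have h5 : dbarCoeff (Fin 2 → ℂ) (fun q => σ q (coframe L p q)) p =
      ι.toFun p (β.1 p (coordVec p p 1) (coframe L p p)) :=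
    (dbar_coordVec _ p).symm.trans (hβ p _ (holDualAt_coframe (L := L) hp) _).symm
  have h6 : (N.c ι).toFun p (coordVec p p 1) (frame L p p) =
      ι.proj D p (N.toFun (fun q => ι.toFun q (frame L p q)) p (coordVec p p 1)) :=
    N.cAt_apply ι (holAt_frame (L := L) hp) _
  have h7 : ∀ a b : E p, D.toFun p a b = -D.toFun p b a := fun a b => by
    have h8 := D.alternating p (a + b)
    simp only [map_add, LinearMap.add_apply, D.alternating, zero_add, add_zero] at h8
    linear_combination h8
  rw [dzbar_const_mul lam hd, D.dzbar_pairing hw hu, h5, wedgeCoeff, trace_wedge β _ hp, h6, h7,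
    ← coframe_smul_frame hp (β.1 p (coordVec p p 1) (coframe L p p)), map_smul, map_smul,
    LinearMap.smul_apply, smul_eq_mul, map_smul, coframe_frame hp]
  simp only [Embedding.proj, LinearMap.flip_apply, LinearMap.comp_apply, smul_eq_mul]
  ring

end ConnectionForm

end RiemannSurface

end

theorem corollary2p8 {X : Type*} [TopologicalSpace X] [ChartedSpace ℂ X] [IsManifold 𝓘(ℂ) ω X]
    [T2Space X] [CompactSpace X] [ConnectedSpace X]
    -- the holomorphic line bundle `L`
    {L : X → Type*} [TopologicalSpace (TotalSpace ℂ L)] [∀ p, AddCommGroup (L p)]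
    [∀ p, Module ℂ (L p)] [∀ p, TopologicalSpace (L p)] [FiberBundle ℂ L] [VectorBundle ℂ ℂ L]
    [ContMDiffVectorBundle ω ℂ L 𝓘(ℂ)]
    -- the holomorphic rank-2 bundle `E`, with trivial determinant
    {E : X → Type*} [TopologicalSpace (TotalSpace (Fin 2 → ℂ) E)] [∀ p, AddCommGroup (E p)]
    [∀ p, Module ℂ (E p)] [∀ p, TopologicalSpace (E p)] [FiberBundle (Fin 2 → ℂ) E]
    [VectorBundle ℂ (Fin 2 → ℂ) E] [ContMDiffVectorBundle ω (Fin 2 → ℂ) E 𝓘(ℂ)]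
    (D : RiemannSurface.DetTrivialization E)
    -- the embedding `L ↪ E` and its extension class
    (ι : RiemannSurface.Embedding L E) (x : RiemannSurface.H1Sq L) (hx : ι.IsExtensionClass D x)
    -- the `SL₂` `λ`-connection on `E`
    (lam : ℂ) (N : RiemannSurface.LambdaConnection lam D) :
    RiemannSurface.serrePairing (N.c ι) x = lam * RiemannSurface.degree L := by
  -- `serrePairing` integrates the chosen representative `Quotient.out x`, so the splitting is
  -- adapted to that one.
  obtain ⟨σ, hσ, hs, hβ⟩ := hx.exists_splitting (β := Quotient.out x) (Quotient.out_eq x)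
  set h := (RiemannSurface.HermitianMetric.nonempty L).some with hh
  have key := RiemannSurface.integral_add_eq_zero
    (θ := fun p v w => lam * h.curvature p v w)
    (RiemannSurface.wedge_eq (Quotient.out x) (N.c ι))
    -- The curvature is by definition `∂̄∂ log |e|²`, in the frame and chart at each point, times
    -- the bracket of `dz̄ ∧ dz`.
    (fun p v w => (mul_assoc lam _ _).symm)
    (RiemannSurface.contForm_wedgeCoeff _ _) (N.smoothForm_connForm hσ hs h)
    (N.dbarForm_connForm hσ hs hβ h)
  rw [RiemannSurface.integral_const_mul] at key
  rw [RiemannSurface.serrePairing, RiemannSurface.degree, ← hh, eq_neg_of_add_eq_zero_left key]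
  have hπ : (Real.pi : ℂ) ≠ 0 := by exact_mod_cast Real.pi_ne_zero
  field_simp
  -- What remains is `-1/(2πi) = i/(2π)`.
  linear_combination (-lam * RiemannSurface.integral h.curvature) * Complex.I_sq
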